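/- Theorem (recurrence for $M_k$). A permutation $\pi\in\mathcal S_n$ contains $\sigma\in\mathcal S_m$ if there are indices $i_1<\dots<i_m$ such that $\pi_{i_1}\cdots\pi_{i_m}$ is in the same relative order as $\sigma_1\cdots\sigma_m$; otherwise $\pi$ avoids $\sigma$. For $k\ge 0$ let $\mathcal S_n(132,12\cdots(k+1))$ be the set of permutations in $\mathcal S_n$ avoiding both $132$ and $12\cdots(k+1)$, let $\mathrm{fp}(\pi)$ be the number of fixed points of $\pi$, and let $$M_k(x,z)=\sum_{n\ge0}\ \sum_{\pi\in\mathcal S_n(132,12\cdots(k+1))}x^{\mathrm{fp}(\pi)}z^n,\qquad M_{-1}(x,z)=0,$$ regarded as formal power series in $z$ with coefficients in $\mathbb Q[x]$. Let $U_m$ be the Chebyshev polynomials of the second kind, given by $U_0(t)=1$, $U_1(t)=2t$, $U_r(t)=2tU_{r-1}(t)-U_{r-2}(t)$. Then for all $0\le\ell\le k$ the element $\dfrac{U_\ell(1/(2z))}{z\,U_{k+1}(1/(2z))}$ of the field $\mathbb Q((z))$ is well defined and is a formal power series $$\frac{U_\ell(1/(2z))}{z\,U_{k+1}(1/(2z))}=\sum_{n\ge0}g_{k,\ell}(n)z^n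 ,$$ and, with $G_{k,\ell}(z)=\sum_{n\ge0}g_{k,\ell}(n)^2z^n$, for every $k\ge0$, $$M_k(x,z)=\sum_{\ell=0}^{k}G_{k,\ell}(z)\bigl(1+(x-1)\,z\,M_{\ell-1}(x,z)\bigr).$$ -/

import Mathlib

namespace PatternAvoid

/-- A permutation pattern: a permutation of `{1, …, m}` (indexed by `Fin m`) together with its
length `m`. -/
abbrev Pattern : Type := (m : ℕ) × Equiv.Perm (Fin m)

/-- `π` contains `σ` if there are indices `i₁ < ⋯ < iₘ` such that `π(i₁) ⋯ π(iₘ)` is in the same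
relative order as `σ(1) ⋯ σ(m)`. -/
def Contains {n : ℕ} (π : Equiv.Perm (Fin n)) (σ : Pattern) : Prop :=
  ∃ i : Fin σ.1 → Fin n, StrictMono i ∧ ∀ a b, π (i a) < π (i b) ↔ σ.2 a < σ.2 b

open Classical in
/-- `S_n(P)`: the permutations in `S_n` avoiding every pattern in `P`. -/
noncomputable def avoiders (P : Set Pattern) (n : ℕ) : Finset (Equiv.Perm (Fin n)) :=
  Finset.univ.filter fun π => ∀ σ ∈ P, ¬ Contains π σ

/-- The number of fixed points. -/
def fp {n : ℕ} (π : Equiv.Perm (Fin n)) : ℕ := (Finset.univ.filter fun i => π i = i).card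

/-- The number of excedances. -/
def exc {n : ℕ} (π : Equiv.Perm (Fin n)) : ℕ := (Finset.univ.filter fun i => i < π i).card

/-- `F_P(x, q, z) = ∑_{n ≥ 0} ∑_{π ∈ S_n(P)} x^{fp π} q^{exc π} z^n`, a formal power series in `z`
for elements `x`, `q` of any commutative ring. -/
noncomputable def F {R : Type*} [CommRing R] (P : Set Pattern) (x q : R) : PowerSeries R :=
  PowerSeries.mk fun n => ∑ π ∈ avoiders P n, x ^ fp π * q ^ exc π

/-- The pattern `132`. -/
def pattern132 : Pattern := ⟨3, Equiv.swap 1 2⟩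

/-- The increasing pattern `12⋯m`. -/
def increasing (m : ℕ) : Pattern := ⟨m, Equiv.refl (Fin m)⟩

/-- `M_k(x, z) = F_{132, 12⋯(k+1)}(x, 1, z)` for `k ≥ 0`, a power series in `z` over `ℚ[x]`;
`M_{-1} = 0`. (Smaller indices do not occur.) -/
noncomputable def M : ℤ → PowerSeries (Polynomial ℚ)
  | Int.ofNat k => F {pattern132, increasing (k + 1)} Polynomial.X 1
  | Int.negSucc _ => 0

/-- The variable `z`, as a Laurent series. -/
noncomputable def zL : LaurentSeries ℚ := HahnSeries.single 1 1

/-- `U_m(1/(2z))` in the field `ℚ((z))`, where `U_m` is the Chebyshev polynomial of the second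
kind. -/
noncomputable def UL (m : ℕ) : LaurentSeries ℚ :=
  Polynomial.aeval (1 / (2 * zL)) (Polynomial.Chebyshev.U ℚ (m : ℤ))

/-- `U_ℓ(1/(2z)) / (z U_{k+1}(1/(2z)))` in the field `ℚ((z))`. -/
noncomputable def Gtilde (k l : ℕ) : LaurentSeries ℚ := UL l / (zL * UL (k + 1))

/-- `g_{k,ℓ}(n)`: the coefficient of `z^n` in `U_ℓ(1/(2z)) / (z U_{k+1}(1/(2z)))`. -/
noncomputable def g (k l n : ℕ) : ℚ := (Gtilde k l).coeff (n : ℤ)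

/-- `G_{k,ℓ}(z) = ∑_{n ≥ 0} g_{k,ℓ}(n)² z^n`, as a power series over `ℚ[x]`. -/
noncomputable def G (k l : ℕ) : PowerSeries (Polynomial ℚ) :=
  PowerSeries.mk fun n => Polynomial.C (g k l n ^ 2)

end PatternAvoid

/-! A permutation avoids `132` and `12⋯(k+1)` exactly when, for every point, the points weakly above
and to the right of it form an increasing sequence of length at most `k` (`mem_avoiders_iff_good`).

Suppose a block of `m` positions `[q, q + m)` is mapped onto itself, with `q` points to its upper
left, `q` to its lower right, and `r` increasing points to its upper right (the diagonal points).
The points above the block have a pattern `β` of length `q + r`, increasing from position `q` on; so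
does the inverse `c` of the pattern to the right. The block carries a pattern `α` that must be good
for `k - r`, because the `r` diagonal points prolong every increasing sequence in it. The triple
`(β, c, α)` is otherwise free (`good_glue_iff`, `sum_corner`).

The number of choices for `β` is the number of paths with `2q + r` steps from `0` to `r` in the
strip `0, …, k` (`card_tailPerms_eq_stripPaths`). The linear system for the strip generating
functions is the Chebyshev recurrence read from the top of the strip, so this number is `g_{k,ℓ}(2q
+ r)` with `ℓ = k - r` (`g_eq_stripPaths`). The independent choices of `β` and `c` produce its
square.

Every good permutation has exactly one such corner with `m = 0`; this yields the terms `G_{k,ℓ}`.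
For the statistic, `x^fp = 1 + (x - 1) ∑ x^(fixed points before i)`, over the fixed points `i`. Each
fixed point is the last point of the block of exactly one corner, and all earlier fixed points lie
in that block. Removing `i` from the block leaves a permutation counted by `M_{ℓ-1}`, and `i` itself
accounts for the factor `z`. -/

namespace PatternAvoid

/-! ### Avoidance as a local condition -/

/-- The points of the graph of `π` weakly above and to the right of the point at position `a`. -/
def upper {n : ℕ} (π : Equiv.Perm (Fin n)) (a : Fin n) : Finset (Fin n) :=
  Finset.univ.filter fun b => a ≤ b ∧ π a ≤ π b

theorem mem_upper {n : ℕ} {π : Equiv.Perm (Fin n)} {a b : Fin n} :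
    b ∈ upper π a ↔ a ≤ b ∧ π a ≤ π b := by
  simp [upper]

/-- The points weakly above and to the right of the one at `a` form an increasing sequence of
length at most `k`. -/
def GoodAt {n : ℕ} (k : ℕ) (π : Equiv.Perm (Fin n)) (a : Fin n) : Prop :=
  StrictMonoOn π (upper π a) ∧ (upper π a).card ≤ k

/-- `GoodAt k π a` for all positions `a`. -/
def Good {n : ℕ} (k : ℕ) (π : Equiv.Perm (Fin n)) : Prop := ∀ a, GoodAt k π a

theorem contains_pattern132_iff {n : ℕ} {π : Equiv.Perm (Fin n)} :
    Contains π pattern132 ↔ ∃ a b c, a < b ∧ b < c ∧ π a < π c ∧ π c < π b := by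
  constructor
  · rintro ⟨i, hi, h⟩
    change ∀ a b : Fin 3, _ at h
    change StrictMono (i : Fin 3 → Fin n) at hi
    refine ⟨i (0 : Fin 3), i (1 : Fin 3), i (2 : Fin 3), hi (by decide), hi (by decide), ?_, ?_⟩
    · exact (h 0 2).2 (by decide)
    · exact (h 2 1).2 (by decide)
  · rintro ⟨a, b, c, hab, hbc, hac, hcb⟩
    refine ⟨(![a, b, c] : Fin 3 → Fin n), ?_, ?_⟩
    · change StrictMono (![a, b, c] : Fin 3 → Fin n)
      rw [Fin.strictMono_iff_lt_succ]
      intro i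
      fin_cases i
      · exact hab
      · exact hbc
    · change ∀ u v : Fin 3, π ((![a, b, c] : Fin 3 → Fin n) u) < π ((![a, b, c] : Fin 3 → Fin n) v) ↔
        Equiv.swap (1 : Fin 3) 2 u < Equiv.swap (1 : Fin 3) 2 v
      have h0 : Equiv.swap (1 : Fin 3) 2 0 = 0 := by decide
      have h1 : Equiv.swap (1 : Fin 3) 2 1 = 2 := by decide
      have h2 : Equiv.swap (1 : Fin 3) 2 2 = 1 := by decide
      have hab' := hac.trans hcb
      intro u v
      fin_cases u <;> fin_cases v <;>
        simp [h0, h1, h2, hac, hcb, hab', hac.le, hcb.le, hab'.le, not_lt]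

theorem contains_increasing_iff {n m : ℕ} {π : Equiv.Perm (Fin n)} :
    Contains π (increasing m) ↔
      ∃ s : Finset (Fin n), s.card = m ∧ StrictMonoOn π s := by
  constructor
  · rintro ⟨i, hi, h⟩
    change Fin m → Fin n at i
    refine ⟨Finset.univ.map ⟨i, hi.injective⟩, by simp, ?_⟩
    intro x hx y hy hxy
    simp only [Finset.coe_map, Finset.coe_univ, Set.image_univ,
      Set.mem_range] at hx hy
    obtain ⟨u, rfl⟩ := hx
    obtain ⟨v, rfl⟩ := hy
    exact (h u v).2 (hi.lt_iff_lt.1 hxy)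
  · rintro ⟨s, hs, h⟩
    refine ⟨s.orderEmbOfFin hs, (s.orderEmbOfFin hs).strictMono, ?_⟩
    intro u v
    exact (h.lt_iff_lt (s.orderEmbOfFin_mem hs u) (s.orderEmbOfFin_mem hs v)).trans
      (OrderEmbedding.lt_iff_lt _)

/-- A descent among the points above and to the right of `a` completes `a` to a `132`. An increasing
set lies above and to the right of its first point, so bounding these local sequences bounds all
increasing ones. -/
theorem mem_avoiders_iff_good {n k : ℕ} {π : Equiv.Perm (Fin n)} :
    π ∈ avoiders {pattern132, increasing (k + 1)} n ↔ Good k π := by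
  simp only [avoiders, Finset.mem_filter, Finset.mem_univ, true_and, Set.mem_insert_iff,
    Set.mem_singleton_iff, forall_eq_or_imp, forall_eq, contains_pattern132_iff,
    contains_increasing_iff]
  constructor
  · rintro ⟨h1, h2⟩ a
    have hm : StrictMonoOn π (upper π a) := by
      intro b hb c hc hbc
      rw [Finset.mem_coe, mem_upper] at hb hc
      by_contra hlt
      have hcb : π c < π b := lt_of_le_of_ne (not_lt.1 hlt) (by simpa using hbc.ne')
      rcases hb.1.eq_or_lt with rfl | hab
      · exact absurd hc.2 (not_le.2 hcb)
      · refine h1 ⟨a, b, c, hab, hbc, lt_of_le_of_ne hc.2 ?_, hcb⟩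
        simpa using (hab.trans hbc).ne
    refine ⟨hm, ?_⟩
    by_contra hk
    obtain ⟨s, hs, hsc⟩ := Finset.exists_subset_card_eq (Nat.succ_le_of_lt (not_le.1 hk))
    exact h2 ⟨s, hsc, hm.mono (by exact_mod_cast hs)⟩
  · intro h
    refine ⟨?_, ?_⟩
    · rintro ⟨a, b, c, hab, hbc, hac, hcb⟩
      refine absurd ((h a).1 ?_ ?_ hbc) (not_lt.2 hcb.le)
      · exact mem_upper.2 ⟨hab.le, (hac.trans hcb).le⟩
      · exact mem_upper.2 ⟨(hab.trans hbc).le, hac.le⟩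
    · rintro ⟨s, hs, hm⟩
      have hne : s.Nonempty := by rw [← Finset.card_pos]; omega
      have : s ⊆ upper π (s.min' hne) := fun x hx =>
        mem_upper.2 ⟨s.min'_le x hx, hm.monotoneOn (s.min'_mem hne) hx (s.min'_le x hx)⟩
      have := (Finset.card_le_card this).trans (h _).2
      omega

/-! ### Embedded patterns and rigidity of increasing parts -/

/-- Transfer of `GoodAt` along an embedding of a pattern `σ` into `π`, when the only points of `π`
above the given one are those of the pattern and an increasing set `T` lying above the whole
pattern. -/
theorem goodAt_add_card_iff {s n k : ℕ} {σ : Equiv.Perm (Fin s)} {π : Equiv.Perm (Fin n)}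
    {e : Fin s → Fin n} (he : StrictMono e) (hval : ∀ u v, σ u < σ v → π (e u) < π (e v))
    {T : Finset (Fin n)} (hT : StrictMonoOn π T)
    (hTe : ∀ t ∈ T, ∀ u, e u < t ∧ π (e u) < π t) {a : Fin s}
    (hup : ∀ x, e a ≤ x → π (e a) ≤ π x → (∃ b, x = e b) ∨ x ∈ T) :
    GoodAt (k + T.card) π (e a) ↔ GoodAt k σ a := by
  have hle : ∀ u v, π (e u) ≤ π (e v) ↔ σ u ≤ σ v := by
    intro u v
    constructor
    · intro h
      by_contra hc
      exact absurd h (not_le.2 (hval v u (not_le.1 hc)))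
    · intro h
      rcases h.eq_or_lt with h | h
      · rw [σ.injective h]
      · exact (hval u v h).le
  have hU : upper π (e a) = (upper σ a).map ⟨e, he.injective⟩ ∪ T := by
    ext x
    simp only [Finset.mem_union, Finset.mem_map, mem_upper, Function.Embedding.coeFn_mk]
    constructor
    · rintro ⟨h1, h2⟩
      rcases hup x h1 h2 with ⟨b, rfl⟩ | h
      · exact Or.inl ⟨b, ⟨he.le_iff_le.1 h1, (hle a b).1 h2⟩, rfl⟩
      · exact Or.inr h
    · rintro (⟨b, ⟨h1, h2⟩, rfl⟩ | h)
      · exact ⟨he.le_iff_le.2 h1, (hle a b).2 h2⟩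
      · exact ⟨(hTe x h a).1.le, (hTe x h a).2.le⟩
  have hd : Disjoint ((upper σ a).map ⟨e, he.injective⟩) T := by
    rw [Finset.disjoint_left]
    intro x hx hxT
    obtain ⟨b, -, rfl⟩ := Finset.mem_map.1 hx
    exact lt_irrefl _ (hTe _ hxT b).1
  rw [GoodAt, GoodAt, hU, Finset.card_union_of_disjoint hd, Finset.card_map,
    Nat.add_le_add_iff_right]
  refine and_congr_left fun _ => ⟨?_, ?_⟩
  · intro h b hb c hc hbc
    have := h (a := e b) (b := e c) (by simp [he.injective.eq_iff] at hb ⊢; exact Or.inl hb)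
      (by simp [he.injective.eq_iff] at hc ⊢; exact Or.inl hc) (he hbc)
    exact lt_of_not_ge fun hge => absurd ((hle c b).2 hge) (not_le.2 this)
  · intro h x hx y hy hxy
    simp only [Finset.coe_union, Set.mem_union, Finset.mem_coe, Finset.mem_map,
      Function.Embedding.coeFn_mk] at hx hy
    rcases hx with ⟨b, hb, rfl⟩ | hx
    · rcases hy with ⟨c, hc, rfl⟩ | hy
      · exact hval b c (h hb hc (he.lt_iff_lt.1 hxy))
      · exact (hTe y hy b).2
    · rcases hy with ⟨c, hc, rfl⟩ | hy
      · exact absurd hxy (not_lt.2 (hTe x hx c).1.le)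
      · exact hT hx hy hxy

theorem goodAt_iff_of_embed {s n k : ℕ} {σ : Equiv.Perm (Fin s)} {π : Equiv.Perm (Fin n)}
    {e : Fin s → Fin n} (he : StrictMono e) (hval : ∀ u v, σ u < σ v → π (e u) < π (e v))
    {a : Fin s} (hup : ∀ x, e a ≤ x → π (e a) ≤ π x → ∃ b, x = e b) :
    GoodAt k π (e a) ↔ GoodAt k σ a := by
  simpa using goodAt_add_card_iff (k := k) (T := ∅) he hval (by simp [StrictMonoOn]) (by simp)
    (fun x h1 h2 => Or.inl (hup x h1 h2))

/-- Two permutations that are increasing on `S` and agree off `S` are equal. -/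
theorem perm_eq_of_strictMonoOn {n : ℕ} {π ρ : Equiv.Perm (Fin n)} {S : Set (Fin n)}
    (hπ : StrictMonoOn π S) (hρ : StrictMonoOn ρ S) (h : ∀ t ∉ S, π t = ρ t) : π = ρ := by
  have key : ∀ {π ρ : Equiv.Perm (Fin n)}, StrictMonoOn π S → StrictMonoOn ρ S →
      (∀ t ∉ S, π t = ρ t) → ∀ t ∈ S, (∀ s < t, π s = ρ s) → ¬ π t < ρ t := by
    intro π ρ _ hρ h t htS ih hlt
    -- If `π t < ρ t`, then `ρ` has no place for the value `π t`: earlier positions agree with `π`,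
    -- later ones in `S` carry larger values, and those off `S` agree again.
    obtain ⟨s, hs⟩ := ρ.surjective (π t)
    by_cases hsS : s ∈ S
    · rcases lt_trichotomy s t with hst | rfl | hst
      · rw [← ih s hst] at hs
        exact hst.ne (π.injective hs)
      · exact hlt.ne' hs
      · have := hρ htS hsS hst
        rw [hs] at this
        exact lt_asymm this hlt
    · rw [← h s hsS] at hs
      exact hsS (π.injective hs ▸ htS)
  ext1 t
  induction t using WellFoundedLT.induction with
  | ind t ih =>
    by_cases ht : t ∈ S
    · have h1 := key hπ hρ h t ht ih
      have h2 := key hρ hπ (fun s hs => (h s hs).symm) t ht fun s hs => (ih s hs).symm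
      exact le_antisymm (not_lt.1 h2) (not_lt.1 h1)
    · exact h t ht

/-! ### Inserting a point -/

/-- The permutation obtained from `σ` by inserting the value `v` at position `p`. -/
def insertPoint {n : ℕ} (p v : Fin (n + 1)) (σ : Equiv.Perm (Fin n)) : Equiv.Perm (Fin (n + 1)) :=
  (finSuccEquiv' p).trans ((Equiv.optionCongr σ).trans (finSuccEquiv' v).symm)

@[simp]
theorem insertPoint_self {n : ℕ} (p v : Fin (n + 1)) (σ : Equiv.Perm (Fin n)) :
    insertPoint p v σ p = v := by
  simp [insertPoint]

@[simp]
theorem insertPoint_succAbove {n : ℕ} (p v : Fin (n + 1)) (σ : Equiv.Perm (Fin n)) (j : Fin n) :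
    insertPoint p v σ (p.succAbove j) = v.succAbove (σ j) := by
  simp [insertPoint]

theorem insertPoint_injective {n : ℕ} (p v : Fin (n + 1)) :
    Function.Injective (insertPoint (n := n) p v) := by
  intro σ τ h
  ext1 j
  have := congrArg (fun f : Equiv.Perm (Fin (n + 1)) => f (p.succAbove j)) h
  simpa using this

theorem exists_eq_insertPoint {n : ℕ} {p v : Fin (n + 1)} {π : Equiv.Perm (Fin (n + 1))}
    (h : π p = v) : ∃ σ, π = insertPoint p v σ := by
  have hj : ∀ j, ∃ i, v.succAbove i = π (p.succAbove j) := fun j => by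
    rw [Fin.exists_succAbove_eq_iff, ← h]
    simp
  choose f hf using hj
  have hinj : Function.Injective f := by
    intro i j hij
    have := hf i
    rw [hij, hf j] at this
    simpa using this.symm
  refine ⟨Equiv.ofBijective f (Finite.injective_iff_bijective.1 hinj), ?_⟩
  ext1 x
  rcases Fin.eq_self_or_eq_succAbove p x with rfl | ⟨j, rfl⟩
  · simpa using h
  · rw [insertPoint_succAbove, Equiv.ofBijective_apply, hf]

/-- The new point lies above and to the right of all others, so it lengthens each of their
increasing sequences by exactly one. -/
theorem good_insertPoint_last_iff {n k : ℕ} {σ : Equiv.Perm (Fin n)} :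
    Good (k + 1) (insertPoint (Fin.last n) (Fin.last n) σ) ↔ Good k σ := by
  have hs : ∀ a, GoodAt (k + 1) (insertPoint (Fin.last n) (Fin.last n) σ)
      ((Fin.last n).succAbove a) ↔ GoodAt k σ a := by
    intro a
    rw [← goodAt_add_card_iff (k := k) (T := {Fin.last n}) (e := (Fin.last n).succAbove)
      (π := insertPoint (Fin.last n) (Fin.last n) σ) (Fin.strictMono_succAbove _)]
    · simp
    · intro u v h
      rw [insertPoint_succAbove, insertPoint_succAbove]
      exact Fin.strictMono_succAbove _ h
    · simp
    · intro t ht u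
      rw [Finset.mem_singleton] at ht
      subst ht
      rw [insertPoint_succAbove, insertPoint_self]
      simp [Fin.castSucc_lt_last]
    · intro x _ _
      rcases Fin.eq_self_or_eq_succAbove (Fin.last n) x with rfl | ⟨j, rfl⟩
      · simp
      · exact Or.inl ⟨j, rfl⟩
  constructor
  · intro h a
    exact (hs a).1 (h _)
  · intro h x
    rcases Fin.eq_self_or_eq_succAbove (Fin.last n) x with rfl | ⟨j, rfl⟩
    · have : upper (insertPoint (Fin.last n) (Fin.last n) σ) (Fin.last n) = {Fin.last n} := by
        ext x
        simp only [mem_upper, Fin.last_le_iff, insertPoint_self, Finset.mem_singleton]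
        exact ⟨fun h => h.1, fun h => by simp [h]⟩
      rw [GoodAt, this]
      simp
    · exact (hs j).2 (h j)

theorem not_good_zero {n : ℕ} (π : Equiv.Perm (Fin (n + 1))) : ¬ Good 0 π := fun h => by
  have := (h 0).2
  rw [Nat.le_zero, Finset.card_eq_zero] at this
  have h0 : (0 : Fin (n + 1)) ∈ upper π 0 := mem_upper.2 ⟨le_rfl, le_rfl⟩
  rw [this] at h0
  simp at h0

/-! ### Good permutations with an increasing tail -/

open Classical in
/-- The good permutations of length `s` that are increasing on the positions from `q` on. -/
noncomputable def tailPerms (k q s : ℕ) : Finset (Equiv.Perm (Fin s)) :=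
  Finset.univ.filter fun π => Good k π ∧ StrictMonoOn π {t | q ≤ t.val}

theorem mem_tailPerms {k q s : ℕ} {π : Equiv.Perm (Fin s)} :
    π ∈ tailPerms k q s ↔ Good k π ∧ StrictMonoOn π {t | q ≤ t.val} := by
  simp [tailPerms]

theorem le_add_of_mem_tailPerms {k q s : ℕ} {π : Equiv.Perm (Fin s)} (h : π ∈ tailPerms k q s) :
    s ≤ q + k := by
  rw [mem_tailPerms] at h
  by_contra hs
  have hq : q < s := by omega
  have hsub : Finset.Ici (⟨q, hq⟩ : Fin s) ⊆ upper π ⟨q, hq⟩ := fun x hx => by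
    rw [Finset.mem_Ici] at hx
    exact mem_upper.2 ⟨hx, h.2.monotoneOn (le_refl q) hx hx⟩
  have h1 := (Finset.card_le_card hsub).trans (h.1 _).2
  rw [Fin.card_Ici] at h1
  simp only at h1
  omega

theorem card_tailPerms_eq_zero {k q s : ℕ} (h : q + k < s) : (tailPerms k q s).card = 0 := by
  rw [Finset.card_eq_zero, Finset.eq_empty_iff_forall_notMem]
  intro π hπ
  have := le_add_of_mem_tailPerms hπ
  omega

theorem card_tailPerms_zero {k s : ℕ} (h : s ≤ k) : (tailPerms k 0 s).card = 1 := by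
  rw [Finset.card_eq_one]
  refine ⟨1, ?_⟩
  ext π
  rw [mem_tailPerms, Finset.mem_singleton]
  constructor
  · rintro ⟨-, h⟩
    refine perm_eq_of_strictMonoOn h (ρ := 1) (fun a _ b _ hab => hab) fun t ht => ?_
    simp at ht
  · rintro rfl
    refine ⟨fun a => ⟨fun a _ b _ hab => hab, ?_⟩, fun a _ b _ hab => hab⟩
    exact (Finset.card_le_univ _).trans (by simpa using h)

/-- A tail of at most one position is increasing for free. This matches the forced last step of a
path ending at height `0`. -/
theorem card_tailPerms_self (k s : ℕ) :
    (tailPerms k (s + 1) (s + 1)).card = (tailPerms k s (s + 1)).card := by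
  congr 1
  ext π
  rw [mem_tailPerms, mem_tailPerms]
  refine and_congr_right fun _ => iff_of_true ?_ ?_
  · intro a ha
    exact absurd a.2 (not_lt.2 ha)
  · intro a ha b hb hab
    have ha' : s ≤ a.val := ha
    have := b.2
    have : a.val < b.val := hab
    omega

/-- A point of value `0` is above no other point, so the old conditions are unaffected. Its own
sequence is the whole tail, of length `n - q ≤ k`. -/
theorem insertPoint_zero_mem_tailPerms_iff {k q n : ℕ} (hk : n ≤ q + k) {p : Fin (n + 1)}
    (hp : p.val = q + 1) {σ : Equiv.Perm (Fin n)} :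
    insertPoint p 0 σ ∈ tailPerms k (q + 1) (n + 1) ↔ σ ∈ tailPerms k (q + 1) n := by
  rw [mem_tailPerms, mem_tailPerms]
  have hge : ∀ j : Fin n, q + 1 ≤ (p.succAbove j).val ↔ q + 1 ≤ j.val := by
    intro j
    rcases lt_or_ge j.castSucc p with h | h
    · rw [Fin.succAbove_of_castSucc_lt _ _ h]
      simp
    · rw [Fin.succAbove_of_le_castSucc _ _ h]
      have : p.val ≤ j.val := h
      rw [Fin.val_succ]
      omega
  have hmono : StrictMonoOn (insertPoint p 0 σ) {t | q + 1 ≤ t.val} ↔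
      StrictMonoOn σ {t | q + 1 ≤ t.val} := by
    constructor
    · intro h a ha b hb hab
      have := h (a := p.succAbove a) (b := p.succAbove b) ((hge a).2 ha) ((hge b).2 hb)
        (Fin.strictMono_succAbove p hab)
      rw [insertPoint_succAbove, insertPoint_succAbove] at this
      exact (Fin.strictMono_succAbove _).lt_iff_lt.1 this
    · intro h x hx y hy hxy
      rcases Fin.eq_self_or_eq_succAbove p y with rfl | ⟨b, rfl⟩
      · have hx' : q + 1 ≤ x.val := hx
        have : x.val < y.val := hxy
        omega
      · rcases Fin.eq_self_or_eq_succAbove p x with rfl | ⟨a, rfl⟩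
        · rw [insertPoint_self, insertPoint_succAbove]
          simp
        · rw [insertPoint_succAbove, insertPoint_succAbove]
          exact Fin.strictMono_succAbove _
            (h ((hge a).1 hx) ((hge b).1 hy) ((Fin.strictMono_succAbove p).lt_iff_lt.1 hxy))
  have hs : ∀ a, GoodAt k (insertPoint p 0 σ) (p.succAbove a) ↔ GoodAt k σ a := by
    intro a
    refine goodAt_iff_of_embed (Fin.strictMono_succAbove p) ?_ ?_
    · intro u v h
      rw [insertPoint_succAbove, insertPoint_succAbove]
      exact Fin.strictMono_succAbove _ h
    · intro x _ hx
      rcases Fin.eq_self_or_eq_succAbove p x with rfl | ⟨j, rfl⟩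
      · rw [insertPoint_succAbove, insertPoint_self] at hx
        simp at hx
      · exact ⟨j, rfl⟩
  rw [hmono]
  refine and_congr_left fun hm => ⟨fun h a => (hs a).1 (h _), fun h x => ?_⟩
  rcases Fin.eq_self_or_eq_succAbove p x with rfl | ⟨j, rfl⟩
  · have hu : upper (insertPoint x 0 σ) x = Finset.Ici x := by
      ext y
      simp [mem_upper]
    rw [GoodAt, hu, Fin.card_Ici]
    refine ⟨(hmono.2 hm).mono fun y hy => ?_, by omega⟩
    have : x.val ≤ y.val := by simpa using hy
    change q + 1 ≤ y.val
    omega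
  · exact (hs j).2 (h j)

/-- If the value `0` is not at the head `p` of the tail, it sits at a position at most `q`, since
the tail increases. Everything after it is then increasing by goodness, so the tail extends to `q`.
-/
theorem strictMonoOn_tail_iff {k q n : ℕ} {p : Fin (n + 1)} (hp : p.val = q + 1)
    {π : Equiv.Perm (Fin (n + 1))} (hπ : π ∈ tailPerms k (q + 1) (n + 1)) :
    StrictMonoOn π {t | q ≤ t.val} ↔ π p ≠ 0 := by
  rw [mem_tailPerms] at hπ
  have hq : q < n + 1 := by omega
  have hqp : (⟨q, hq⟩ : Fin (n + 1)) < p := by rw [Fin.lt_def]; simp only; omega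
  have hp' : p ∈ {t : Fin (n + 1) | q + 1 ≤ t.val} := hp.ge
  constructor
  · intro h h0
    have := h (le_refl q) (show q ≤ p.val by omega) hqp
    rw [h0] at this
    simp at this
  · intro h0
    have hlt : π ⟨q, hq⟩ < π p := by
      by_contra hc
      obtain ⟨a, ha⟩ := π.surjective 0
      have hcp : π p < π ⟨q, hq⟩ := lt_of_le_of_ne (not_lt.1 hc) (by simpa using hqp.ne')
      rcases lt_trichotomy a p with h | rfl | h
      · have haq : a ≤ ⟨q, hq⟩ := by
          have : a.val < p.val := h
          rw [Fin.le_def]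
          simp only
          omega
        refine absurd ((hπ.1 a).1 ?_ ?_ hqp) hc
        · exact mem_upper.2 ⟨haq, by simp [ha]⟩
        · exact mem_upper.2 ⟨h.le, by simp [ha]⟩
      · exact h0 ha
      · have hap : p.val < a.val := h
        have := hπ.2 hp' (show q + 1 ≤ a.val by omega) h
        rw [ha] at this
        simp at this
    have hqx : ∀ x : Fin (n + 1), q ≤ x.val → x = ⟨q, hq⟩ ∨ q + 1 ≤ x.val := by
      intro x hx
      rcases hx.eq_or_lt with h | h
      · exact Or.inl (Fin.ext h.symm)
      · exact Or.inr h
    intro x hx y hy hxy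
    have hxy' : x.val < y.val := hxy
    have hx' : q ≤ x.val := hx
    have hy1 : q + 1 ≤ y.val := by omega
    rcases hqx x hx with rfl | h
    · refine hlt.trans_le (hπ.2.monotoneOn hp' hy1 ?_)
      rw [Fin.le_def]
      omega
    · exact hπ.2 h hy1 hxy

/-- Either the value `0` heads the tail and can be deleted, or the tail extends one position to the
left. -/
theorem card_tailPerms_succ_succ {k q n : ℕ} (hq : q + 1 ≤ n) (hk : n ≤ q + k) :
    (tailPerms k (q + 1) (n + 1)).card =
      (tailPerms k (q + 1) n).card + (tailPerms k q (n + 1)).card := by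
  classical
  have hp : ((⟨q + 1, by omega⟩ : Fin (n + 1)) : ℕ) = q + 1 := rfl
  set p : Fin (n + 1) := ⟨q + 1, by omega⟩
  rw [← Finset.card_filter_add_card_filter_not (s := tailPerms k (q + 1) (n + 1))
    (fun π => π p = 0)]
  congr 1
  · rw [← Finset.card_map ⟨insertPoint p 0, insertPoint_injective p 0⟩]
    congr 1
    ext π
    simp only [Finset.mem_filter, Finset.mem_map, Function.Embedding.coeFn_mk]
    constructor
    · rintro ⟨h, h0⟩
      obtain ⟨σ, rfl⟩ := exists_eq_insertPoint h0
      exact ⟨σ, (insertPoint_zero_mem_tailPerms_iff hk hp).1 h, rfl⟩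
    · rintro ⟨σ, h, rfl⟩
      exact ⟨(insertPoint_zero_mem_tailPerms_iff hk hp).2 h, insertPoint_self _ _ _⟩
  · congr 1
    ext π
    rw [Finset.mem_filter]
    constructor
    · rintro ⟨h, h0⟩
      exact mem_tailPerms.2 ⟨(mem_tailPerms.1 h).1, (strictMonoOn_tail_iff hp h).2 h0⟩
    · intro h
      rw [mem_tailPerms] at h
      have h' : π ∈ tailPerms k (q + 1) (n + 1) := mem_tailPerms.2
        ⟨h.1, h.2.mono fun x (hx : q + 1 ≤ x.val) => (Nat.le_of_succ_le hx : q ≤ x.val)⟩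
      exact ⟨h', (strictMonoOn_tail_iff hp h').1 h.2⟩

/-! ### Paths in a strip -/

/-- The number of paths with `n` steps `±1` from height `0` to height `r` in the strip of heights
`0, …, k`. -/
def stripPaths (k : ℕ) : ℕ → ℕ → ℕ
  | 0, r => if r = 0 then 1 else 0
  | n + 1, 0 => stripPaths k n 1
  | n + 1, r + 1 => if r + 1 ≤ k then stripPaths k n r + stripPaths k n (r + 2) else 0

theorem stripPaths_eq_zero_of_lt {k n r : ℕ} (h : k < r) : stripPaths k n r = 0 := by
  cases n with
  | zero => rw [stripPaths, if_neg (by omega)]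
  | succ n =>
    cases r with
    | zero => omega
    | succ r => rw [stripPaths, if_neg (by omega)]

theorem exists_of_stripPaths_ne_zero {k n r : ℕ} (h : stripPaths k n r ≠ 0) :
    ∃ q, 2 * q + r = n := by
  induction n generalizing r with
  | zero =>
    rw [stripPaths] at h
    exact ⟨0, by by_contra h'; exact h (if_neg (by omega))⟩
  | succ n ih =>
    cases r with
    | zero =>
      obtain ⟨q, hq⟩ := ih h
      exact ⟨q + 1, by omega⟩
    | succ r =>
      rw [stripPaths] at h
      split_ifs at h with hk
      by_cases h1 : stripPaths k n r = 0
      · obtain ⟨q, hq⟩ := ih (r := r + 2) (by omega)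
        exact ⟨q + 1, by omega⟩
      · obtain ⟨q, hq⟩ := ih h1
        exact ⟨q, by omega⟩
      · exact absurd rfl h

theorem card_tailPerms_eq_stripPaths (k q r : ℕ) :
    (tailPerms k q (q + r)).card = stripPaths k (2 * q + r) r := by
  suffices ∀ n q r, 2 * q + r = n → (tailPerms k q (q + r)).card = stripPaths k n r from
    this _ q r rfl
  intro n
  induction n with
  | zero =>
    intro q r h
    obtain ⟨rfl, rfl⟩ : q = 0 ∧ r = 0 := by omega
    exact card_tailPerms_zero (Nat.zero_le k)
  | succ n ih =>
    intro q r h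
    rcases lt_or_ge k r with hk | hk
    · rw [card_tailPerms_eq_zero (by omega), stripPaths_eq_zero_of_lt hk]
    · cases r with
      | zero =>
        obtain ⟨q, rfl⟩ : ∃ q', q = q' + 1 := ⟨q - 1, by omega⟩
        rw [add_zero, card_tailPerms_self, ih q 1 (by omega), stripPaths]
      | succ r =>
        rw [stripPaths, if_pos hk]
        cases q with
        | zero =>
          -- For `q = 0` there are only `n = r` steps, too few to reach height `r + 2`.
          have h2 : stripPaths k n (r + 2) = 0 := by
            by_contra h0
            obtain ⟨q, hq⟩ := exists_of_stripPaths_ne_zero h0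
            omega
          rw [h2, ← ih 0 r (by omega), zero_add, zero_add, card_tailPerms_zero hk,
            card_tailPerms_zero (by omega)]
        | succ q =>
          rw [← add_assoc, card_tailPerms_succ_succ (by omega) (by omega),
            ih (q + 1) r (by omega), ← ih q (r + 2) (by omega),
            show q + (r + 2) = q + 1 + r + 1 by omega]

/-! ### Strip generating functions and Chebyshev polynomials -/

/-- The generating function of the paths in the strip that end at height `r`. -/
noncomputable def stripSeries (k r : ℕ) : PowerSeries ℚ :=
  PowerSeries.mk fun n => (stripPaths k n r : ℚ)

theorem stripSeries_zero (k : ℕ) :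
    stripSeries k 0 = 1 + PowerSeries.X * stripSeries k 1 := by
  ext n
  cases n with
  | zero => simp [stripSeries, stripPaths]
  | succ n =>
    rw [map_add, PowerSeries.coeff_succ_X_mul]
    simp [stripSeries, stripPaths, PowerSeries.coeff_one]

theorem stripSeries_succ {k r : ℕ} (h : r + 1 ≤ k) :
    stripSeries k (r + 1) = PowerSeries.X * (stripSeries k r + stripSeries k (r + 2)) := by
  ext n
  cases n with
  | zero => simp [stripSeries, stripPaths]
  | succ n =>
    rw [PowerSeries.coeff_succ_X_mul]
    simp [stripSeries, stripPaths, h]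

theorem stripSeries_eq_zero {k r : ℕ} (h : k < r) : stripSeries k r = 0 := by
  ext n
  simp [stripSeries, stripPaths_eq_zero_of_lt h]

theorem zL_ne_zero : zL ≠ 0 := by
  rw [zL]
  exact HahnSeries.single_ne_zero one_ne_zero

theorem two_ne_zero_laurentSeries : (2 : LaurentSeries ℚ) ≠ 0 := by
  rw [← map_ofNat (algebraMap ℚ (LaurentSeries ℚ)) 2]
  exact (map_ne_zero _).2 two_ne_zero

theorem UL_zero : UL 0 = 1 := by
  simp [UL]

theorem zL_mul_UL_one : zL * UL 1 = 1 := by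
  have hz := zL_ne_zero
  have h2 := two_ne_zero_laurentSeries
  rw [UL, Nat.cast_one, Polynomial.Chebyshev.U_one, map_mul, Polynomial.aeval_X, map_ofNat]
  field_simp

theorem zL_mul_UL_add_two (m : ℕ) : zL * UL (m + 2) = UL (m + 1) - zL * UL m := by
  have hz := zL_ne_zero
  have h2 := two_ne_zero_laurentSeries
  simp only [UL, Nat.cast_add, Nat.cast_ofNat, Nat.cast_one, Polynomial.Chebyshev.U_add_two,
    map_sub, map_mul, Polynomial.aeval_X, map_ofNat]
  field_simp

/-- The generating function of the paths in the strip ending at height `r`, as a Laurent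
series. -/
noncomputable def stripLaurent (k r : ℕ) : LaurentSeries ℚ :=
  HahnSeries.ofPowerSeries ℤ ℚ (stripSeries k r)

theorem ofPowerSeries_X_eq_zL : HahnSeries.ofPowerSeries ℤ ℚ PowerSeries.X = zL := by
  rw [HahnSeries.ofPowerSeries_X, zL]

theorem stripLaurent_zero (k : ℕ) : stripLaurent k 0 = 1 + zL * stripLaurent k 1 := by
  rw [stripLaurent, stripSeries_zero, map_add, map_mul, ofPowerSeries_X_eq_zL, map_one,
    stripLaurent]

theorem stripLaurent_succ {k r : ℕ} (h : r + 1 ≤ k) :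
    stripLaurent k (r + 1) = zL * (stripLaurent k r + stripLaurent k (r + 2)) := by
  rw [stripLaurent, stripSeries_succ h, map_mul, ofPowerSeries_X_eq_zL, map_add,
    stripLaurent, stripLaurent]

theorem stripLaurent_eq_zero {k r : ℕ} (h : k < r) : stripLaurent k r = 0 := by
  rw [stripLaurent, stripSeries_eq_zero h, map_zero]

/-- The series vanishes at height `k + 1`; going down from the top, each series is `1/z` times the
one above it minus the one two above, which is the Chebyshev recurrence at `1/(2z)`. -/
theorem stripLaurent_eq_UL_mul {k j r : ℕ} (h : j + r = k) :
    stripLaurent k r = UL j * stripLaurent k k := by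
  have hz := zL_ne_zero
  induction j using Nat.strong_induction_on generalizing r with
  | _ j ih =>
    match j with
    | 0 =>
      obtain rfl : r = k := by omega
      rw [UL_zero, one_mul]
    | 1 =>
      have h1 := stripLaurent_succ (k := k) (r := r) (by omega)
      rw [stripLaurent_eq_zero (show k < r + 2 by omega), add_zero,
        show r + 1 = k by omega] at h1
      have h2 := zL_mul_UL_one
      linear_combination (-stripLaurent k r) * h2 - UL 1 * h1
    | j + 2 =>
      have h1 := stripLaurent_succ (k := k) (r := r) (by omega)
      rw [ih j (by omega) (show j + (r + 2) = k by omega),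
        ih (j + 1) (by omega) (show j + 1 + (r + 1) = k by omega)] at h1
      have h2 := zL_mul_UL_add_two j
      apply mul_left_cancel₀ hz
      linear_combination -h1 - stripLaurent k k * h2

/-- The equation at height `0` is the only inhomogeneous one and fixes the remaining scalar; it also
forces `UL (k + 1)` to be non-zero. -/
theorem zL_mul_UL_mul_stripLaurent (k : ℕ) : zL * UL (k + 1) * stripLaurent k k = 1 := by
  have h0 := stripLaurent_zero k
  cases k with
  | zero =>
    rw [stripLaurent_eq_zero (show 0 < 1 by omega), mul_zero, add_zero] at h0
    rw [h0, mul_one, zero_add, zL_mul_UL_one]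
  | succ k =>
    rw [stripLaurent_eq_UL_mul (show k + 1 + 0 = k + 1 by rfl),
      stripLaurent_eq_UL_mul (show k + 1 = k + 1 by rfl)] at h0
    have h2 := zL_mul_UL_add_two k
    linear_combination h0 + stripLaurent (k + 1) (k + 1) * h2

theorem UL_succ_ne_zero (k : ℕ) : UL (k + 1) ≠ 0 := by
  intro h
  have := zL_mul_UL_mul_stripLaurent k
  simp [h] at this

theorem Gtilde_eq_stripLaurent {k l r : ℕ} (h : l + r = k) : Gtilde k l = stripLaurent k r := by
  rw [Gtilde, stripLaurent_eq_UL_mul h,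
    div_eq_iff (mul_ne_zero zL_ne_zero (UL_succ_ne_zero k))]
  linear_combination (-UL l) * zL_mul_UL_mul_stripLaurent k

theorem g_eq_stripPaths {k l r : ℕ} (h : l + r = k) (n : ℕ) : g k l n = stripPaths k n r := by
  rw [g, Gtilde_eq_stripLaurent h, stripLaurent, HahnSeries.ofPowerSeries_apply_coeff,
    stripSeries, PowerSeries.coeff_mk]

theorem ofPowerSeries_mk_g {k l : ℕ} (h : l ≤ k) :
    HahnSeries.ofPowerSeries ℤ ℚ (PowerSeries.mk (g k l)) = UL l / (zL * UL (k + 1)) := by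
  obtain ⟨r, rfl⟩ := Nat.exists_eq_add_of_le h
  rw [← Gtilde, Gtilde_eq_stripLaurent rfl, stripLaurent, stripSeries]
  congr 2
  ext n
  exact g_eq_stripPaths rfl n

/-! ### Corners and gluing -/

/-- The position block `[q, q + m)` is mapped to itself, everything before it is mapped above it,
and the points above and to the right of it form an increasing sequence. -/
def Corner {n : ℕ} (q m : ℕ) (π : Equiv.Perm (Fin n)) : Prop :=
  (∀ t, t.val < q → q + m ≤ (π t).val) ∧
  (∀ t, (q ≤ t.val ∧ t.val < q + m) ↔ (q ≤ (π t).val ∧ (π t).val < q + m)) ∧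
  StrictMonoOn π {t | q + m ≤ t.val ∧ q + m ≤ (π t).val}

theorem Corner.symm {n q m : ℕ} {π : Equiv.Perm (Fin n)} (h : Corner q m π) :
    Corner q m π.symm := by
  obtain ⟨ha, hb, hc⟩ := h
  refine ⟨fun v hv => ?_, fun v => ?_, fun v hv w hw hvw => ?_⟩
  · have h1 := ha (π.symm v)
    have h2 := hb (π.symm v)
    rw [π.apply_symm_apply] at h1 h2
    omega
  · have h2 := hb (π.symm v)
    rw [π.apply_symm_apply] at h2
    exact h2.symm
  · by_contra hlt
    have h1 : π.symm w < π.symm v := lt_of_le_of_ne (not_lt.1 hlt) (by simpa using hvw.ne')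
    have h2 := hc (a := π.symm w) (b := π.symm v) (by simpa using hw.symm) (by simpa using hv.symm) h1
    rw [π.apply_symm_apply, π.apply_symm_apply] at h2
    exact lt_asymm h2 hvw

section Glue

variable {q m s n : ℕ} (hn : q + m + s = n) (hq : q ≤ s) (β c : Equiv.Perm (Fin s))
  (α : Equiv.Perm (Fin m))

/-- The function underlying `glue`. -/
def glueFun (t : Fin n) : Fin n :=
  if h1 : t.val < q then ⟨q + m + β ⟨t.val, by omega⟩, by omega⟩
  else if h2 : t.val < q + m then ⟨q + α ⟨t.val - q, by omega⟩, by omega⟩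
  -- A position beyond the block has label `u` under `c⁻¹`: for `u < q` the point lies to the lower
  -- right and has value `u`; for `q ≤ u` it is a diagonal point, shared with `β`.
  else if (c.symm ⟨t.val - (q + m), by omega⟩).val < q then
    ⟨c.symm ⟨t.val - (q + m), by omega⟩, by omega⟩
  else ⟨q + m + β (c.symm ⟨t.val - (q + m), by omega⟩), by omega⟩

variable {hn hq β c α}

theorem glueFun_low {t : Fin n} {u : Fin s} (ht : t.val = u.val) (hu : u.val < q) :
    (glueFun hn hq β c α t).val = q + m + β u := by
  rw [glueFun, dif_pos (by omega)]
  simp [ht]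

theorem glueFun_mid {t : Fin n} {u : Fin m} (ht : t.val = q + u.val) :
    (glueFun hn hq β c α t).val = q + α u := by
  rw [glueFun, dif_neg (by omega), dif_pos (by omega)]
  simp [ht]

theorem glueFun_right {t : Fin n} {u : Fin s} (ht : t.val = q + m + c u) (hu : u.val < q) :
    (glueFun hn hq β c α t).val = u := by
  have h : c.symm ⟨t.val - (q + m), by omega⟩ = u := by
    rw [Equiv.symm_apply_eq]
    ext
    simp [ht]
  rw [glueFun, dif_neg (by omega), dif_neg (by omega)]
  simp [h, hu]

theorem glueFun_diag {t : Fin n} {u : Fin s} (ht : t.val = q + m + c u) (hu : q ≤ u.val) :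
    (glueFun hn hq β c α t).val = q + m + β u := by
  have h : c.symm ⟨t.val - (q + m), by omega⟩ = u := by
    rw [Equiv.symm_apply_eq]
    ext
    simp [ht]
  rw [glueFun, dif_neg (by omega), dif_neg (by omega)]
  simp [h, not_lt.2 hu]

theorem glue_cases (hn : q + m + s = n) (hq : q ≤ s) (c : Equiv.Perm (Fin s)) (t : Fin n) :
    (∃ u : Fin s, t.val = u.val ∧ u.val < q) ∨ (∃ u : Fin m, t.val = q + u.val) ∨
    (∃ u : Fin s, t.val = q + m + c u ∧ u.val < q) ∨
    (∃ u : Fin s, t.val = q + m + c u ∧ q ≤ u.val) := by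
  by_cases h1 : t.val < q
  · exact Or.inl ⟨⟨t.val, by omega⟩, rfl, h1⟩
  by_cases h2 : t.val < q + m
  · refine Or.inr (Or.inl ⟨⟨t.val - q, by omega⟩, ?_⟩)
    simp only
    omega
  have h3 : t.val = q + m + c (c.symm ⟨t.val - (q + m), by omega⟩) := by
    rw [Equiv.apply_symm_apply]
    simp only
    omega
  rcases lt_or_ge (c.symm ⟨t.val - (q + m), by omega⟩).val q with h | h
  · exact Or.inr (Or.inr (Or.inl ⟨_, h3, h⟩))
  · exact Or.inr (Or.inr (Or.inr ⟨_, h3, h⟩))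

/-- Transposing the graph exchanges upper left and lower right, hence `β` and `c`, and preserves the
block and the diagonal points. -/
theorem glueFun_glueFun (t : Fin n) :
    glueFun hn hq c β α.symm (glueFun hn hq β c α t) = t := by
  rcases glue_cases hn hq c t with ⟨u, h, hu⟩ | ⟨u, h⟩ | ⟨u, h, hu⟩ | ⟨u, h, hu⟩
  · ext
    rw [glueFun_right (glueFun_low h hu) hu, h]
  · ext
    rw [glueFun_mid (glueFun_mid h), Equiv.symm_apply_apply, h]
  · ext
    rw [glueFun_low (glueFun_right h hu) hu, h]
  · ext
    rw [glueFun_diag (glueFun_diag h hu) hu, h]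

variable (hn hq β c α) in
/-- The permutation with the block `α` on `[q, q + m)`, with the pattern `β` formed by the points
above this block and the pattern `c⁻¹` formed by the points to the right of it. -/
def glue : Equiv.Perm (Fin n) where
  toFun := glueFun hn hq β c α
  invFun := glueFun hn hq c β α.symm
  left_inv := glueFun_glueFun
  right_inv t := by
    have := glueFun_glueFun (hn := hn) (hq := hq) (β := c) (c := β) (α := α.symm) t
    rwa [Equiv.symm_symm] at this

theorem glue_symm : (glue hn hq β c α).symm = glue hn hq c β α.symm := by
  ext t
  rfl

theorem glue_low {t : Fin n} {u : Fin s} (ht : t.val = u.val) (hu : u.val < q) :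
    (glue hn hq β c α t).val = q + m + β u :=
  glueFun_low (hn := hn) (hq := hq) ht hu

theorem glue_mid {t : Fin n} {u : Fin m} (ht : t.val = q + u.val) :
    (glue hn hq β c α t).val = q + α u :=
  glueFun_mid (hn := hn) (hq := hq) ht

theorem glue_right {t : Fin n} {u : Fin s} (ht : t.val = q + m + c u) (hu : u.val < q) :
    (glue hn hq β c α t).val = u :=
  glueFun_right (hn := hn) (hq := hq) ht hu

theorem glue_diag {t : Fin n} {u : Fin s} (ht : t.val = q + m + c u) (hu : q ≤ u.val) :
    (glue hn hq β c α t).val = q + m + β u :=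
  glueFun_diag (hn := hn) (hq := hq) ht hu

theorem corner_glue (hβ : StrictMonoOn β {t | q ≤ t.val}) (hc : StrictMonoOn c {t | q ≤ t.val}) :
    Corner q m (glue hn hq β c α) := by
  have hD : ∀ t : Fin n, q + m ≤ t.val → q + m ≤ (glue hn hq β c α t).val →
      ∃ u : Fin s, t.val = q + m + c u ∧ q ≤ u.val := by
    intro t h1 h2
    rcases glue_cases hn hq c t with ⟨u, h, hu⟩ | ⟨u, h⟩ | ⟨u, h, hu⟩ | h
    · omega
    · omega
    · rw [glue_right h hu] at h2
      omega
    · exact h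
  refine ⟨?_, ?_, ?_⟩
  · intro t ht
    have := glue_low (hn := hn) (hq := hq) (β := β) (c := c) (α := α) (t := t)
      (u := ⟨t.val, by omega⟩) rfl ht
    omega
  · intro t
    rcases glue_cases hn hq c t with ⟨u, h, hu⟩ | ⟨u, h⟩ | ⟨u, h, hu⟩ | ⟨u, h, hu⟩
    · rw [glue_low h hu]
      omega
    · rw [glue_mid h]
      omega
    · rw [glue_right h hu]
      omega
    · rw [glue_diag h hu]
      omega
  · rintro t ⟨ht1, ht2⟩ t' ⟨ht1', ht2'⟩ htt
    obtain ⟨u, h, hu⟩ := hD t ht1 ht2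
    obtain ⟨u', h', hu'⟩ := hD t' ht1' ht2'
    rw [Fin.lt_def] at htt ⊢
    rw [glue_diag h hu, glue_diag h' hu']
    have h1 : c u < c u' := by rw [Fin.lt_def]; omega
    have h2 := hβ hu hu' ((hc.lt_iff_lt hu hu').1 h1)
    rw [Fin.lt_def] at h2
    omega

variable (hn c) in
/-- The positions in `glue hn hq β c α` of the points of the pattern `β`. -/
def glueEmb (u : Fin s) : Fin n := if u.val < q then ⟨u, by omega⟩ else ⟨q + m + c u, by omega⟩

theorem glueEmb_of_lt {u : Fin s} (hu : u.val < q) : (glueEmb hn c u).val = u := by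
  simp [glueEmb, hu]

theorem glueEmb_of_ge {u : Fin s} (hu : q ≤ u.val) : (glueEmb hn c u).val = q + m + c u := by
  simp [glueEmb, not_lt.2 hu]

theorem glueEmb_strictMono (hc : StrictMonoOn c {t | q ≤ t.val}) :
    StrictMono (glueEmb hn c) := by
  intro u v huv
  rw [Fin.lt_def]
  rcases lt_or_ge u.val q with hu | hu
  · rw [glueEmb_of_lt hu]
    rcases lt_or_ge v.val q with hv | hv
    · rw [glueEmb_of_lt hv]
      exact huv
    · rw [glueEmb_of_ge hv]
      omega
  · have hv : q ≤ v.val := hu.trans huv.le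
    rw [glueEmb_of_ge hu, glueEmb_of_ge hv]
    exact Nat.add_lt_add_left (hc hu hv huv) _

theorem glue_glueEmb (u : Fin s) :
    (glue hn hq β c α (glueEmb hn c u)).val = q + m + β u := by
  rcases lt_or_ge u.val q with hu | hu
  · rw [glue_low (glueEmb_of_lt hu) hu]
  · rw [glue_diag (glueEmb_of_ge hu) hu]

theorem exists_eq_glueEmb {t : Fin n} (ht : q + m ≤ (glue hn hq β c α t).val) :
    ∃ u, t = glueEmb hn c u := by
  rcases glue_cases hn hq c t with ⟨u, h, hu⟩ | ⟨u, h⟩ | ⟨u, h, hu⟩ | ⟨u, h, hu⟩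
  · exact ⟨u, Fin.ext (by rw [glueEmb_of_lt hu, h])⟩
  · rw [glue_mid h] at ht
    omega
  · rw [glue_right h hu] at ht
    omega
  · exact ⟨u, Fin.ext (by rw [glueEmb_of_ge hu, h])⟩

/-- The embedded pattern `β` consists of all points with value at least `q + m`, so nothing outside
it can lie above one of its points. -/
theorem goodAt_glueEmb {k : ℕ} (hc : StrictMonoOn c {t | q ≤ t.val}) (u : Fin s) :
    GoodAt k (glue hn hq β c α) (glueEmb hn c u) ↔ GoodAt k β u := by
  refine goodAt_iff_of_embed (glueEmb_strictMono hc) ?_ ?_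
  · intro u v h
    rw [Fin.lt_def] at h ⊢
    rw [glue_glueEmb, glue_glueEmb]
    omega
  · intro x _ hx
    rw [Fin.le_def, glue_glueEmb] at hx
    exact exists_eq_glueEmb (hq := hq) (β := β) (α := α) (by omega)

theorem goodAt_glue_mid {k : ℕ} (hβ : StrictMonoOn β {t | q ≤ t.val})
    (hc : StrictMonoOn c {t | q ≤ t.val}) (hk : s ≤ q + k) {t : Fin n} {u : Fin m}
    (ht : t.val = q + u) :
    GoodAt k (glue hn hq β c α) t ↔ GoodAt (k - (s - q)) α u := by
  -- `T` is the set of the `s - q` diagonal points, which lie above and to the right of the whole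
  -- block.
  set T : Finset (Fin n) := (Finset.univ.filter fun u : Fin s => q ≤ u.val).map
    ⟨glueEmb hn c, (glueEmb_strictMono hc).injective⟩ with hT
  have hcard : T.card = s - q := by
    rw [hT, Finset.card_map]
    rcases hq.eq_or_lt with h | h
    · rw [← h, Nat.sub_self, Finset.card_eq_zero, Finset.filter_eq_empty_iff]
      intro x _
      omega
    · have : (Finset.univ.filter fun u : Fin s => q ≤ u.val) = Finset.Ici ⟨q, h⟩ := by
        ext x
        simp [Fin.le_def]
      rw [this, Fin.card_Ici]
  have hmem : ∀ t ∈ T, q + m ≤ t.val ∧ q + m ≤ (glue hn hq β c α t).val := by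
    intro t ht
    obtain ⟨v, hv, rfl⟩ := Finset.mem_map.1 ht
    rw [Finset.mem_filter] at hv
    rw [Function.Embedding.coeFn_mk, glue_glueEmb, glueEmb_of_ge hv.2]
    omega
  have hte : t = (⟨q + u.val, by omega⟩ : Fin n) := Fin.ext ht
  rw [hte]
  have := goodAt_add_card_iff (k := k - (s - q)) (σ := α) (π := glue hn hq β c α)
    (e := fun u : Fin m => (⟨q + u.val, by omega⟩ : Fin n)) (T := T) (a := u) ?_ ?_ ?_ ?_ ?_
  · rw [hcard, show k - (s - q) + (s - q) = k by omega] at this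
    exact this
  · intro a b hab
    exact Nat.add_lt_add_left hab _
  · intro a b hab
    rw [Fin.lt_def] at hab ⊢
    rw [glue_mid (u := a) rfl, glue_mid (u := b) rfl]
    omega
  · exact (corner_glue hβ hc).2.2.mono hmem
  · intro t ht a
    have := hmem t ht
    rw [Fin.lt_def, Fin.lt_def, glue_mid (u := a) rfl]
    simp only
    omega
  · intro x h1 h2
    rw [Fin.le_def] at h1 h2
    rw [glue_mid (u := u) rfl] at h2
    simp only at h1
    rcases glue_cases hn hq c x with ⟨v, h, hv⟩ | ⟨v, h⟩ | ⟨v, h, hv⟩ | ⟨v, h, hv⟩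
    · omega
    · exact Or.inl ⟨v, Fin.ext h⟩
    · rw [glue_right h hv] at h2
      omega
    · refine Or.inr (Finset.mem_map.2 ⟨v, by simpa using hv, Fin.ext ?_⟩)
      rw [Function.Embedding.coeFn_mk, glueEmb_of_ge hv, h]

end Glue

/-! ### Goodness, uniqueness and existence of the gluing data -/

theorem goodAt_symm {n k : ℕ} {π : Equiv.Perm (Fin n)} {a : Fin n} (h : GoodAt k π a) :
    GoodAt k π.symm (π a) := by
  have hU : upper π.symm (π a) = (upper π a).map π.toEmbedding := by
    ext x
    simp [mem_upper, Finset.mem_map_equiv, and_comm]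
  rw [GoodAt, hU, Finset.card_map]
  refine ⟨?_, h.2⟩
  intro x hx y hy hxy
  rw [Finset.mem_coe, Finset.mem_map_equiv] at hx hy
  rw [← h.1.lt_iff_lt hx hy]
  simpa using hxy

theorem goodAt_symm_iff {n k : ℕ} {π : Equiv.Perm (Fin n)} {a : Fin n} :
    GoodAt k π.symm (π a) ↔ GoodAt k π a :=
  ⟨fun h => by simpa using goodAt_symm h, goodAt_symm⟩

theorem good_symm {n k : ℕ} {π : Equiv.Perm (Fin n)} (h : Good k π) : Good k π.symm := fun a => by
  simpa using goodAt_symm (h (π.symm a))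

/-- Upper-left and diagonal points are controlled by `β`, block points by `α`. The lower-right
points become upper-left points of the inverse, whose pattern is `c`. -/
theorem good_glue_iff {k q m s n : ℕ} {hn : q + m + s = n} {hq : q ≤ s}
    {β c : Equiv.Perm (Fin s)} {α : Equiv.Perm (Fin m)} (hβ : StrictMonoOn β {t | q ≤ t.val})
    (hc : StrictMonoOn c {t | q ≤ t.val}) (hk : s ≤ q + k) :
    Good k (glue hn hq β c α) ↔ Good k β ∧ Good k c ∧ Good (k - (s - q)) α := by
  constructor
  · intro h
    refine ⟨fun u => (goodAt_glueEmb hc u).1 (h _), fun u => ?_, fun u => ?_⟩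
    · have h' := good_symm h
      rw [glue_symm] at h'
      exact (goodAt_glueEmb hβ u).1 (h' _)
    · exact (goodAt_glue_mid hβ hc hk (t := ⟨q + u.val, by omega⟩) rfl).1 (h _)
  · rintro ⟨h1, h2, h3⟩ t
    rcases glue_cases hn hq c t with ⟨u, h, hu⟩ | ⟨u, h⟩ | ⟨u, h, hu⟩ | ⟨u, h, hu⟩
    · obtain rfl : t = glueEmb hn c u := Fin.ext (by rw [h, glueEmb_of_lt hu])
      exact (goodAt_glueEmb hc u).2 (h1 u)
    · exact (goodAt_glue_mid hβ hc hk h).2 (h3 u)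
    · rw [← goodAt_symm_iff, glue_symm]
      have : glue hn hq β c α t = glueEmb hn β u :=
        Fin.ext (by rw [glue_right h hu, glueEmb_of_lt hu])
      rw [this]
      exact (goodAt_glueEmb hβ u).2 (h2 u)
    · obtain rfl : t = glueEmb hn c u := Fin.ext (by rw [h, glueEmb_of_ge hu])
      exact (goodAt_glueEmb hc u).2 (h1 u)

/-- The first `q` values determine `β`, as the rest of it is increasing; inversion gives the same
for `c`. -/
theorem glue_injective {q m s n : ℕ} {hn : q + m + s = n} {hq : q ≤ s}
    {β c β' c' : Equiv.Perm (Fin s)} {α α' : Equiv.Perm (Fin m)}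
    (hβ : StrictMonoOn β {t | q ≤ t.val}) (hβ' : StrictMonoOn β' {t | q ≤ t.val})
    (hc : StrictMonoOn c {t | q ≤ t.val}) (hc' : StrictMonoOn c' {t | q ≤ t.val})
    (h : glue hn hq β c α = glue hn hq β' c' α') : β = β' ∧ c = c' ∧ α = α' := by
  have key : ∀ {β c β' c' : Equiv.Perm (Fin s)} {α α' : Equiv.Perm (Fin m)},
      StrictMonoOn β {t | q ≤ t.val} → StrictMonoOn β' {t | q ≤ t.val} →
      glue hn hq β c α = glue hn hq β' c' α' → β = β' := by
    intro β c β' c' α α' hβ hβ' h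
    refine perm_eq_of_strictMonoOn hβ hβ' fun u hu => ?_
    have hu' : u.val < q := not_le.1 hu
    have h1 := glue_low (hn := hn) (hq := hq) (β := β) (c := c) (α := α)
      (t := ⟨u, by omega⟩) rfl hu'
    have h2 := glue_low (hn := hn) (hq := hq) (β := β') (c := c') (α := α')
      (t := ⟨u, by omega⟩) rfl hu'
    rw [h] at h1
    exact Fin.ext (by omega)
  refine ⟨key hβ hβ' h, ?_, ?_⟩
  · have h' := congrArg Equiv.symm h
    rw [glue_symm, glue_symm] at h'
    exact key hc hc' h'
  · ext u
    have h1 := glue_mid (hn := hn) (hq := hq) (β := β) (c := c) (α := α)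
      (t := ⟨q + u, by omega⟩) (u := u) rfl
    rw [h, glue_mid (u := u) rfl] at h1
    omega

/-- A function injective on the first `q` positions extends to a permutation that is increasing on
the remaining ones. -/
theorem exists_perm_strictMonoOn {q s : ℕ} (hq : q ≤ s) (f : Fin s → Fin s)
    (hf : Set.InjOn f {u | u.val < q}) :
    ∃ β : Equiv.Perm (Fin s), (∀ u, u.val < q → β u = f u) ∧ StrictMonoOn β {t | q ≤ t.val} := by
  classical
  set R : Finset (Fin s) := (Finset.univ.filter fun u : Fin s => u.val < q).image f with hR
  have hRc : Rᶜ.card = s - q := by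
    rw [Finset.card_compl, Fintype.card_fin, hR, Finset.card_image_of_injOn (by simpa using hf)]
    congr 1
    rw [Fin.card_filter_val_lt]
    exact min_eq_right hq
  let F : Fin s → Fin s := fun u =>
    if h : u.val < q then f u else Rᶜ.orderEmbOfFin hRc ⟨u.val - q, by omega⟩
  have h1 : ∀ u : Fin s, u.val < q → F u = f u := fun u hu => dif_pos hu
  have h2 : ∀ u : Fin s, ∀ h : q ≤ u.val,
      F u = Rᶜ.orderEmbOfFin hRc ⟨u.val - q, by omega⟩ := fun u hu => dif_neg (not_lt.2 hu)
  have hd : ∀ u v : Fin s, u.val < q → q ≤ v.val → F u ≠ F v := by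
    intro u v hu hv h
    have : F v ∈ Rᶜ := by
      rw [h2 v hv]
      exact Finset.orderEmbOfFin_mem _ _ _
    rw [Finset.mem_compl, ← h, h1 u hu] at this
    exact this (Finset.mem_image_of_mem f (by simpa using hu))
  have hm : StrictMonoOn F {t | q ≤ t.val} := by
    intro u hu v hv huv
    rw [h2 u hu, h2 v hv, OrderEmbedding.lt_iff_lt, Fin.lt_def]
    have h3 : q ≤ u.val := hu
    have h4 : u.val < v.val := huv
    simp only
    omega
  have hinj : Function.Injective F := by
    intro u v h
    rcases lt_or_ge u.val q with hu | hu <;> rcases lt_or_ge v.val q with hv | hv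
    · rw [h1 u hu, h1 v hv] at h
      exact hf hu hv h
    · exact absurd h (hd u v hu hv)
    · exact absurd h.symm (hd v u hv hu)
    · exact hm.injOn hu hv h
  exact ⟨Equiv.ofBijective F (Finite.injective_iff_bijective.1 hinj), h1, hm⟩

theorem exists_perm_of_corner {q m s n : ℕ} (hn : q + m + s = n) (hq : q ≤ s)
    {π : Equiv.Perm (Fin n)} (h : ∀ t, t.val < q → q + m ≤ (π t).val) :
    ∃ β : Equiv.Perm (Fin s), StrictMonoOn β {t | q ≤ t.val} ∧
      ∀ (t : Fin n) (u : Fin s), t.val = u.val → u.val < q → (π t).val = q + m + β u := by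
  obtain ⟨β, h1, h2⟩ := exists_perm_strictMonoOn hq
    (fun u => ⟨(π ⟨u.val, by omega⟩).val - (q + m), by have := u.2; omega⟩) (by
      intro u hu v hv huv
      have h1 := h ⟨u.val, by omega⟩ hu
      have h2 := h ⟨v.val, by omega⟩ hv
      simp only [Fin.mk.injEq] at huv
      have h3 := π.injective (Fin.ext (show (π ⟨u.val, by omega⟩).val = (π ⟨v.val, by omega⟩).val by
        omega))
      simpa [Fin.ext_iff] using h3)
  refine ⟨β, h2, fun t u htu hu => ?_⟩
  have hte : t = ⟨u.val, by omega⟩ := Fin.ext htu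
  rw [hte]
  have := h ⟨u.val, by omega⟩ hu
  rw [h1 u hu]
  simp only
  omega

theorem exists_eq_glue {q m s n : ℕ} (hn : q + m + s = n) (hq : q ≤ s)
    {π : Equiv.Perm (Fin n)} (h : Corner q m π) :
    ∃ (β c : Equiv.Perm (Fin s)) (α : Equiv.Perm (Fin m)),
      StrictMonoOn β {t | q ≤ t.val} ∧ StrictMonoOn c {t | q ≤ t.val} ∧
      π = glue hn hq β c α := by
  obtain ⟨β, hβ, hβv⟩ := exists_perm_of_corner hn hq h.1
  obtain ⟨c, hc, hcv⟩ := exists_perm_of_corner hn hq h.symm.1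
  have hb : ∀ u : Fin m, q ≤ (π ⟨q + u.val, by omega⟩).val ∧
      (π ⟨q + u.val, by omega⟩).val < q + m := fun u =>
    (h.2.1 _).1 ⟨by simp, by simp⟩
  let A : Fin m → Fin m := fun u => ⟨(π ⟨q + u.val, by omega⟩).val - q, by have := hb u; omega⟩
  have hA : Function.Injective A := by
    intro u v huv
    have h1 := hb u
    have h2 := hb v
    simp only [A, Fin.mk.injEq] at huv
    have h3 := π.injective (Fin.ext (show (π ⟨q + u.val, by omega⟩).val =
      (π ⟨q + v.val, by omega⟩).val by omega))
    simpa [Fin.ext_iff] using h3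
  refine ⟨β, c, Equiv.ofBijective A (Finite.injective_iff_bijective.1 hA), hβ, hc, ?_⟩
  have hcπ : ∀ (t : Fin n) (u : Fin s), t.val = q + m + c u → u.val < q → (π t).val = u := by
    intro t u ht hu
    have h1 := hcv ⟨u.val, by omega⟩ u rfl hu
    have h2 : t = π.symm ⟨u.val, by omega⟩ := Fin.ext (by rw [h1, ht])
    rw [h2, Equiv.apply_symm_apply]
  -- Both permutations increase on the diagonal positions of `π`, so agreement at all other
  -- positions suffices.
  refine perm_eq_of_strictMonoOn h.2.2 ((corner_glue hβ hc).2.2.mono ?_) ?_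
  · rintro t ⟨ht1, ht2⟩
    refine ⟨ht1, ?_⟩
    rcases glue_cases hn hq c t with ⟨u, h, hu⟩ | ⟨u, h⟩ | ⟨u, h, hu⟩ | ⟨u, h, hu⟩
    · omega
    · omega
    · rw [hcπ t u h hu] at ht2
      omega
    · rw [glue_diag h hu]
      omega
  · intro t ht
    ext
    rcases glue_cases hn hq c t with ⟨u, h', hu⟩ | ⟨u, h'⟩ | ⟨u, h', hu⟩ | ⟨u, h', hu⟩
    · rw [hβv t u h' hu, glue_low h' hu]
    · rw [glue_mid h']
      have hte : t = ⟨q + u.val, by omega⟩ := Fin.ext h'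
      rw [hte]
      have := hb u
      simp only [Equiv.ofBijective_apply, A]
      omega
    · rw [hcπ t u h' hu, glue_right h' hu]
    -- Here `π t < q`, so `t` is also the lower-right position labelled by `π t`; injectivity of `c`
    -- gives `u = π t < q`, a contradiction.
    · exfalso
      have h1 : q + m ≤ t.val := by omega
      have h2 : (π t).val < q := by
        by_contra h2
        have h3 := h.2.1 t
        exact ht ⟨h1, by omega⟩
      have h3 := hcv (π t) ⟨(π t).val, by omega⟩ rfl h2
      rw [Equiv.symm_apply_apply, h'] at h3
      have h4 := c.injective (Fin.ext (show (c u).val = (c ⟨(π t).val, by omega⟩).val by omega))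
      rw [h4] at hu
      simp only at hu
      omega

open Classical in
/-- Sums over the good permutations with a given corner. -/
theorem sum_corner {R : Type*} [AddCommMonoid R] {k q m s n : ℕ} (hn : q + m + s = n) (hq : q ≤ s)
    (hk : s ≤ q + k) (f : Equiv.Perm (Fin n) → R) :
    ∑ π with Good k π ∧ Corner q m π, f π =
      ∑ β ∈ tailPerms k q s, ∑ c ∈ tailPerms k q s, ∑ α with Good (k - (s - q)) α,
        f (glue hn hq β c α) := by
  rw [← Finset.sum_product', ← Finset.sum_product']
  symm
  refine Finset.sum_nbij (fun x => glue hn hq x.1.1 x.1.2 x.2) ?_ ?_ ?_ fun _ _ => rfl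
  · rintro ⟨⟨β, c⟩, α⟩ h
    simp only [Finset.mem_product, mem_tailPerms, Finset.mem_filter, Finset.mem_univ,
      true_and] at h ⊢
    obtain ⟨⟨⟨h1, h2⟩, h3, h4⟩, h5⟩ := h
    exact ⟨(good_glue_iff h2 h4 hk).2 ⟨h1, h3, h5⟩, corner_glue h2 h4⟩
  · rintro ⟨⟨β, c⟩, α⟩ h ⟨⟨β', c'⟩, α'⟩ h' heq
    simp only [Finset.mem_coe, Finset.mem_product, mem_tailPerms] at h h'
    obtain ⟨rfl, rfl, rfl⟩ := glue_injective h.1.1.2 h'.1.1.2 h.1.2.2 h'.1.2.2 heq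
    rfl
  · intro π hπ
    simp only [Finset.coe_filter, Finset.mem_univ, true_and, Set.mem_ofPred_eq] at hπ
    obtain ⟨β, c, α, hβ, hc, rfl⟩ := exists_eq_glue hn hq hπ.2
    obtain ⟨h1, h2, h3⟩ := (good_glue_iff hβ hc hk).1 hπ.1
    refine ⟨((β, c), α), ?_, rfl⟩
    simp [mem_tailPerms, h1, h2, h3, hβ, hc]

theorem le_add_of_good_of_corner {k q m s n : ℕ} (hn : q + m + s = n) (hq : q ≤ s)
    {π : Equiv.Perm (Fin n)} (h : Good k π) (hc : Corner q m π) : s ≤ q + k := by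
  obtain ⟨β, c, α, hβ, hc', rfl⟩ := exists_eq_glue hn hq hc
  exact le_add_of_mem_tailPerms
    (mem_tailPerms.2 ⟨fun u => (goodAt_glueEmb hc' u).1 (h _), hβ⟩)

/-! ### Existence and uniqueness of corners -/

theorem add_le_of_forall_le {n q w : ℕ} {π : Equiv.Perm (Fin n)} (hq : q ≤ n) (hw : w ≤ n)
    (h : ∀ t, t.val < q → w ≤ (π t).val) : q + w ≤ n := by
  have h1 : (Finset.univ.filter fun t : Fin n => t.val < q).card ≤
      (Finset.univ.filter fun t : Fin n => ¬ t.val < w).card :=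
    Finset.card_le_card_of_injOn π (fun t ht => by
      have := h t (by simpa using ht)
      simpa using this) π.injective.injOn
  have h2 := Finset.card_filter_add_card_filter_not (s := (Finset.univ : Finset (Fin n)))
    (fun t => t.val < w)
  rw [Fin.card_filter_val_lt, min_eq_right hq] at h1
  rw [Fin.card_filter_val_lt, min_eq_right hw, Finset.card_univ, Fintype.card_fin] at h2
  omega

theorem exists_corner_zero {k n : ℕ} {π : Equiv.Perm (Fin n)} (h : Good k π) :
    ∃ q r, 2 * q + r = n ∧ Corner q 0 π := by
  have hex : ∃ q, ¬ (q + 1 ≤ n ∧ ∀ t : Fin n, t.val < q + 1 → q + 1 ≤ (π t).val) :=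
    ⟨n, fun h => by omega⟩
  classical
  obtain ⟨q, ⟨hqn, hq⟩, hq1⟩ : ∃ q, (q ≤ n ∧ ∀ t : Fin n, t.val < q → q ≤ (π t).val) ∧
      ¬ (q + 1 ≤ n ∧ ∀ t : Fin n, t.val < q + 1 → q + 1 ≤ (π t).val) := by
    -- The corner is at the least `q` for which the condition fails at `q + 1`; by minimality it
    -- holds at `q`.
    refine ⟨Nat.find hex, ?_, Nat.find_spec hex⟩
    rcases h0 : Nat.find hex with _ | m
    · simp
    · exact not_not.1 (Nat.find_min hex (m := m) (by omega))
  have h2 := add_le_of_forall_le hqn hqn hq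
  refine ⟨q, n - 2 * q, by omega, fun t ht => hq t ht, fun t => by omega, ?_⟩
  rintro t ⟨ht1, ht2⟩ t' ⟨ht1', ht2'⟩ htt
  have hqn : q + 1 ≤ n := by omega
  simp only [hqn, true_and, not_forall] at hq1
  -- The failure at `q + 1` provides a point with position and value at most `q`. Goodness at it
  -- makes all diagonal points increasing.
  obtain ⟨a, ha, ha'⟩ := hq1
  refine (h a).1 ?_ ?_ htt
  · exact mem_upper.2 ⟨Fin.le_def.2 (by omega), Fin.le_def.2 (by omega)⟩
  · exact mem_upper.2 ⟨Fin.le_def.2 (by omega), Fin.le_def.2 (by omega)⟩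

/-- If `q < q'`, the point at position `q` has value at least `q'` and the point of value `q` has
position at least `q'`: a descent among the diagonal points of the corner at `q`. -/
theorem corner_zero_unique {n q q' : ℕ} {π : Equiv.Perm (Fin n)} (hq : q ≤ n) (hq' : q' ≤ n)
    (h : Corner q 0 π) (h' : Corner q' 0 π) : q = q' := by
  have key : ∀ {q q' : ℕ}, q' ≤ n → Corner q 0 π → Corner q' 0 π → ¬ q < q' := by
    intro q q' hq' h h' hlt
    have h1 := h'.1 ⟨q, by omega⟩ hlt
    have h2 := h'.symm.1 ⟨q, by omega⟩ hlt
    have h4 : (⟨q, by omega⟩ : Fin n) ∈ {t : Fin n | q + 0 ≤ t.val ∧ q + 0 ≤ (π t).val} :=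
      ⟨le_refl q, by omega⟩
    have h5 : π.symm ⟨q, by omega⟩ ∈ {t : Fin n | q + 0 ≤ t.val ∧ q + 0 ≤ (π t).val} :=
      ⟨by omega, by simp⟩
    have h3 := h.2.2 h4 h5 (Fin.lt_def.2 (by simp only; omega))
    rw [Equiv.apply_symm_apply, Fin.lt_def] at h3
    simp only at h3
    omega
  exact le_antisymm (not_lt.1 (key hq h' h)) (not_lt.1 (key hq' h h'))

/-- Both blocks end at the same place. If `q < q'`, position `q` must map into one block and above
the other. -/
theorem corner_succ_unique {n q p q' p' : ℕ} {π : Equiv.Perm (Fin n)} (hq : q ≤ n) (hq' : q' ≤ n)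
    (hqp : q + p = q' + p') (h : Corner q (p + 1) π) (h' : Corner q' (p' + 1) π) : q = q' := by
  have key : ∀ {q p q' p' : ℕ}, q + p = q' + p' → q' ≤ n → Corner q (p + 1) π →
      Corner q' (p' + 1) π → ¬ q < q' := by
    intro q p q' p' hqp hq' h h' hlt
    have h1 := h'.1 ⟨q, by omega⟩ hlt
    have h2 := (h.2.1 ⟨q, by omega⟩).1 ⟨le_refl q, by simp only; omega⟩
    omega
  exact le_antisymm (not_lt.1 (key hqp.symm hq h' h)) (not_lt.1 (key hqp hq' h h'))

theorem exists_initial_segment {P : ℕ → Prop} {i : ℕ} (h : ∀ a b, a < b → b < i → P b → P a) :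
    ∃ q ≤ i, ∀ t < i, P t ↔ t < q := by
  induction i with
  | zero => exact ⟨0, le_rfl, by simp⟩
  | succ i ih =>
    by_cases hi : P i
    · refine ⟨i + 1, le_rfl, fun t ht => iff_of_true ?_ ht⟩
      rcases (Nat.lt_succ_iff.1 ht).eq_or_lt with rfl | h'
      · exact hi
      · exact h t i h' (Nat.lt_succ_self i) hi
    · obtain ⟨q, hq, hP⟩ := ih fun a b hab hb => h a b hab (by omega)
      refine ⟨q, by omega, fun t ht => ?_⟩
      rcases (Nat.lt_succ_iff.1 ht).eq_or_lt with rfl | h'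
      · exact iff_of_false hi (by omega)
      · exact hP t h'

/-- If `a < b < i` with `π a ≤ i < π b`, then the points at `a`, `b`, `i` form a `132`; so the
positions before `i` mapped above `i` are closed downwards. -/
theorem exists_excedance_segment {k n : ℕ} {π : Equiv.Perm (Fin n)} (h : Good k π) {i : Fin n}
    (hi : π i = i) : ∃ q ≤ i.val, ∀ t < i, i < π t ↔ t.val < q := by
  obtain ⟨q, hq, hP⟩ := exists_initial_segment (P := fun t => ∃ ht : t < n, i < π ⟨t, ht⟩)
    (i := i.val) (by
      rintro a b hab hb ⟨hbn, hb'⟩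
      refine ⟨by omega, ?_⟩
      by_contra hc
      have hle := not_lt.1 hc
      have h1 : (⟨b, hbn⟩ : Fin n) ∈ upper π ⟨a, by omega⟩ :=
        mem_upper.2 ⟨hab.le, hle.trans hb'.le⟩
      have h2 : i ∈ upper π ⟨a, by omega⟩ := mem_upper.2 ⟨(hab.trans hb).le, by rwa [hi]⟩
      have := (h ⟨a, by omega⟩).1 h1 h2 hb
      rw [hi] at this
      exact lt_asymm this hb')
  refine ⟨q, hq, fun t ht => ?_⟩
  rw [← hP t.val ht]
  exact ⟨fun h => ⟨t.2, h⟩, fun ⟨_, h⟩ => h⟩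

theorem exists_corner_succ {k n : ℕ} {π : Equiv.Perm (Fin n)} (h : Good k π) {i : Fin n}
    (hi : π i = i) :
    ∃ q p r, q + p = i.val ∧ 2 * q + r + (p + 1) = n ∧ Corner q (p + 1) π := by
  have hi' : π.symm i = i := by rw [Equiv.symm_apply_eq, hi]
  obtain ⟨q, hq, hP⟩ := exists_excedance_segment h hi
  obtain ⟨q', hq', hP'⟩ := exists_excedance_segment (good_symm h) hi'
  have hne : ∀ t, t ≠ i → π t ≠ i := fun t ht hc => ht (π.injective (hc.trans hi.symm))
  have hb1 : ∀ t, (q ≤ t.val ∧ t < i) → (q' ≤ (π t).val ∧ π t < i) := by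
    rintro t ⟨h1, h2⟩
    have h3 : π t < i := by
      refine lt_of_le_of_ne (not_lt.1 fun h3 => ?_) (hne t h2.ne)
      have := (hP t h2).1 h3
      omega
    refine ⟨not_lt.1 fun h4 => ?_, h3⟩
    have := (hP' _ h3).2 h4
    rw [Equiv.symm_apply_apply] at this
    exact lt_asymm this h2
  have hb2 : ∀ t, (q' ≤ (π t).val ∧ π t < i) → (q ≤ t.val ∧ t < i) := by
    rintro t ⟨h1, h2⟩
    have h3 : t < i := by
      refine lt_of_le_of_ne (not_lt.1 fun h3 => ?_) fun h3 => ?_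
      · have := (hP' (π t) h2).1 (by rwa [Equiv.symm_apply_apply])
        omega
      · rw [h3, hi] at h2
        exact lt_irrefl _ h2
    refine ⟨not_lt.1 fun h4 => ?_, h3⟩
    exact lt_asymm ((hP t h3).2 h4) h2
  -- The positions in `[q, i)` are mapped bijectively onto the values in `[q', i)`.
  obtain rfl : q = q' := by
    have hc : (Finset.Ico (⟨q, by omega⟩ : Fin n) i).card =
        (Finset.Ico (⟨q', by omega⟩ : Fin n) i).card := by
      refine Finset.card_nbij π ?_ π.injective.injOn ?_
      · intro t ht
        rw [Finset.mem_coe, Finset.mem_Ico] at *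
        exact hb1 t ht
      · intro v hv
        rw [Finset.mem_coe, Finset.mem_Ico] at hv
        refine ⟨π.symm v, ?_, by simp⟩
        rw [Finset.mem_coe, Finset.mem_Ico]
        refine hb2 _ ?_
        rw [Equiv.apply_symm_apply]
        exact hv
    rw [Fin.card_Ico, Fin.card_Ico] at hc
    simp only at hc
    omega
  have hL : ∀ t : Fin n, t.val < q → i.val + 1 ≤ (π t).val := fun t ht =>
    (hP t (Fin.lt_def.2 (by omega))).2 ht
  have hn := add_le_of_forall_le (π := π) (q := q) (w := i.val + 1) (by omega) (by omega) hL
  refine ⟨q, i.val - q, n - (q + (i.val + 1)), by omega, by omega, ?_, ?_, ?_⟩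
  · intro t ht
    have := hL t ht
    omega
  · intro t
    by_cases hti : t = i
    · subst hti
      rw [hi]
    · have h1 := hne t hti
      rw [Ne, Fin.ext_iff] at h1
      rw [Fin.ext_iff] at hti
      have h2 := hb1 t
      have h3 := hb2 t
      rw [Fin.lt_def, Fin.lt_def] at h2 h3
      omega
  · rintro t ⟨ht1, ht2⟩ t' ⟨ht1', ht2'⟩ htt
    refine (h i).1 ?_ ?_ htt
    · exact mem_upper.2 ⟨Fin.le_def.2 (by omega), Fin.le_def.2 (by rw [hi]; omega)⟩
    · exact mem_upper.2 ⟨Fin.le_def.2 (by omega), Fin.le_def.2 (by rw [hi]; omega)⟩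

/-! ### Counting good permutations -/

theorem sq_stripPaths {k a r n : ℕ} (ha : a ≤ n) :
    stripPaths k a r ^ 2 = ∑ q ∈ Finset.range (n + 1),
      if 2 * q + r = a then (tailPerms k q (q + r)).card ^ 2 else 0 := by
  by_cases h : ∃ q, 2 * q + r = a
  · obtain ⟨q, rfl⟩ := h
    rw [Finset.sum_eq_single_of_mem q (by rw [Finset.mem_range]; omega), if_pos rfl,
      card_tailPerms_eq_stripPaths]
    intro b _ hb
    rw [if_neg (by omega)]
  · have h0 : stripPaths k a r = 0 := by
      by_contra h0
      exact h (exists_of_stripPaths_ne_zero h0)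
    rw [h0, Finset.sum_eq_zero]
    · simp
    · intro q _
      rw [if_neg fun hq => h ⟨q, hq⟩]

open Classical in
theorem card_good_eq (k n : ℕ) :
    (Finset.univ.filter fun π : Equiv.Perm (Fin n) => Good k π).card =
      ∑ r ∈ Finset.range (k + 1), stripPaths k n r ^ 2 := by
  simp_rw [sq_stripPaths (le_refl n)]
  rw [← Finset.sum_product', ← Finset.sum_filter, Finset.card_eq_sum_ones]
  have h1 : ∀ π ∈ (Finset.univ.filter fun π : Equiv.Perm (Fin n) => Good k π),
      1 = ∑ x ∈ (Finset.range (k + 1) ×ˢ Finset.range (n + 1)).filter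
        (fun x => 2 * x.2 + x.1 = n), if Corner x.2 0 π then 1 else 0 := by
    intro π hπ
    rw [Finset.mem_filter] at hπ
    obtain ⟨q, r, hqr, hc⟩ := exists_corner_zero hπ.2
    have hk := le_add_of_good_of_corner (show q + 0 + (q + r) = n by omega) (by omega) hπ.2 hc
    rw [Finset.sum_eq_single_of_mem (r, q), if_pos hc]
    · simp only [Finset.mem_filter, Finset.mem_product, Finset.mem_range]
      omega
    · rintro ⟨r', q'⟩ hx hne
      simp only [Finset.mem_filter, Finset.mem_product, Finset.mem_range] at hx
      refine if_neg fun hc' => hne ?_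
      have := corner_zero_unique (by omega) (by omega) hc hc'
      rw [Prod.mk.injEq]
      omega
  rw [Finset.sum_congr rfl h1, Finset.sum_comm]
  refine Finset.sum_congr rfl ?_
  rintro ⟨r, q⟩ hx
  simp only [Finset.mem_filter, Finset.mem_product, Finset.mem_range] at hx ⊢
  rw [← Finset.sum_filter, Finset.filter_filter,
    sum_corner (show q + 0 + (q + r) = n by omega) (by omega) (by omega)]
  -- The block is empty, so only the pair `(β, c)` is counted, giving a square.
  have hα : (Finset.univ.filter fun α : Equiv.Perm (Fin 0) => Good (k - (q + r - q)) α) =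
      Finset.univ := Finset.filter_true_of_mem fun α _ a => a.elim0
  simp_rw [hα]
  simp [sq]

/-! ### Fixed points -/

/-- The number of fixed points before `i`. -/
def fpBelow {n : ℕ} (π : Equiv.Perm (Fin n)) (i : Fin n) : ℕ :=
  (Finset.univ.filter fun j => j < i ∧ π j = j).card

theorem fpBelow_insertPoint_last {p : ℕ} (σ : Equiv.Perm (Fin p)) :
    fpBelow (insertPoint (Fin.last p) (Fin.last p) σ) (Fin.last p) = fp σ := by
  rw [fpBelow, fp]
  symm
  refine Finset.card_nbij (Fin.last p).succAbove ?_
    (Fin.strictMono_succAbove (Fin.last p)).injective.injOn ?_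
  · intro j hj
    rw [Finset.mem_coe, Finset.mem_filter] at hj ⊢
    rw [insertPoint_succAbove, hj.2]
    simp [Fin.castSucc_lt_last]
  · intro x hx
    rw [Finset.mem_coe, Finset.mem_filter] at hx
    rcases Fin.eq_self_or_eq_succAbove (Fin.last p) x with rfl | ⟨j, rfl⟩
    · exact absurd hx.2.1 (lt_irrefl _)
    · refine ⟨j, ?_, rfl⟩
      rw [insertPoint_succAbove] at hx
      simpa using hx.2.2

section Glue

variable {q p s n : ℕ} {hn : q + (p + 1) + s = n} {hq : q ≤ s} {β c : Equiv.Perm (Fin s)}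
  {α : Equiv.Perm (Fin (p + 1))} {i : Fin n}

theorem glue_apply_eq_self_iff (hi : i.val = q + p) :
    glue hn hq β c α i = i ↔ α (Fin.last p) = Fin.last p := by
  rw [Fin.ext_iff, Fin.ext_iff, glue_mid (u := Fin.last p) (by simpa using hi), hi]
  simp

/-- Positions before the block are mapped above it, so every fixed point before the last block
position lies in the block. -/
theorem fpBelow_glue (hi : i.val = q + p) :
    fpBelow (glue hn hq β c α) i = fpBelow α (Fin.last p) := by
  rw [fpBelow, fpBelow]
  symm
  refine Finset.card_nbij (fun j : Fin (p + 1) => (⟨q + j.val, by omega⟩ : Fin n)) ?_ ?_ ?_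
  · intro j hj
    rw [Finset.mem_coe, Finset.mem_filter] at hj ⊢
    refine ⟨Finset.mem_univ _, ?_, ?_⟩
    · rw [Fin.lt_def, hi]
      exact Nat.add_lt_add_left hj.2.1 _
    · ext
      rw [glue_mid (u := j) rfl, hj.2.2]
  · intro a _ b _ hab
    simpa [Fin.ext_iff] using hab
  · intro x hx
    rw [Finset.mem_coe, Finset.mem_filter, Fin.lt_def, Fin.ext_iff, hi] at hx
    obtain ⟨-, hx1, hx2⟩ := hx
    rcases glue_cases hn hq c x with ⟨u, h, hu⟩ | ⟨u, h⟩ | ⟨u, h, hu⟩ | ⟨u, h, hu⟩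
    · rw [glue_low h hu] at hx2
      omega
    · refine ⟨u, ?_, Fin.ext h.symm⟩
      rw [glue_mid h] at hx2
      rw [Finset.mem_coe, Finset.mem_filter, Fin.lt_def, Fin.ext_iff, Fin.val_last]
      exact ⟨Finset.mem_univ _, by omega, by omega⟩
    · omega
    · omega

end Glue

open Classical in
theorem coeff_M (k n : ℕ) :
    PowerSeries.coeff n (M (k : ℤ)) =
      ∑ π : Equiv.Perm (Fin n) with Good k π, (Polynomial.X : Polynomial ℚ) ^ fp π := by
  change PowerSeries.coeff n (F {pattern132, increasing (k + 1)} Polynomial.X 1) = _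
  rw [F, PowerSeries.coeff_mk]
  refine Finset.sum_congr ?_ fun π _ => by simp
  ext π
  simp [mem_avoiders_iff_good]

theorem M_neg_one : M (-1) = 0 := rfl

open Classical in
-- Deleting the fixed last point lowers the bound by one. For `k = 0` no non-empty permutation is
-- good, in accordance with `M (-1) = 0`.
theorem sum_good_fixing_last (k p : ℕ) :
    ∑ α : Equiv.Perm (Fin (p + 1)) with Good k α,
      (if α (Fin.last p) = Fin.last p then
        (Polynomial.X : Polynomial ℚ) ^ fpBelow α (Fin.last p) else 0) =
    PowerSeries.coeff p (M ((k : ℤ) - 1)) := by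
  cases k with
  | zero =>
    rw [Finset.sum_eq_zero, Nat.cast_zero, zero_sub, M_neg_one, map_zero]
    intro α hα
    exact absurd (Finset.mem_filter.1 hα).2 (not_good_zero α)
  | succ k =>
    rw [Nat.cast_succ, add_sub_cancel_right, coeff_M, ← Finset.sum_filter, Finset.filter_filter]
    symm
    refine Finset.sum_nbij (insertPoint (Fin.last p) (Fin.last p)) ?_
      (insertPoint_injective _ _).injOn ?_ ?_
    · intro σ hσ
      rw [Finset.mem_filter] at hσ ⊢
      exact ⟨Finset.mem_univ _, good_insertPoint_last_iff.2 hσ.2, insertPoint_self _ _ _⟩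
    · intro α hα
      rw [Finset.mem_coe, Finset.mem_filter] at hα
      obtain ⟨σ, rfl⟩ := exists_eq_insertPoint hα.2.2
      refine ⟨σ, ?_, rfl⟩
      rw [Finset.mem_coe, Finset.mem_filter]
      exact ⟨Finset.mem_univ _, good_insertPoint_last_iff.1 hα.2.1⟩
    · intro σ _
      rw [fpBelow_insertPoint_last]

open Classical in
-- A pair of a permutation and a fixed point `i` is sorted by the corner whose block ends at `i`: `a
-- = 2q + r` points lie outside the block, and `n - a` lie in it besides `i`.
theorem sum_fixed_points (k n : ℕ) :
    ∑ π : Equiv.Perm (Fin (n + 1)) with Good k π, ∑ i with π i = i,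
      (Polynomial.X : Polynomial ℚ) ^ fpBelow π i =
    ∑ r ∈ Finset.range (k + 1), ∑ x ∈ Finset.HasAntidiagonal.antidiagonal n,
      (stripPaths k x.1 r : Polynomial ℚ) ^ 2 *
        PowerSeries.coeff x.2 (M (((k - r : ℕ) : ℤ) - 1)) := by
  have hR : ∀ r ∈ Finset.range (k + 1), ∑ x ∈ Finset.HasAntidiagonal.antidiagonal n,
      (stripPaths k x.1 r : Polynomial ℚ) ^ 2 *
        PowerSeries.coeff x.2 (M (((k - r : ℕ) : ℤ) - 1)) =
      ∑ a ∈ Finset.range (n + 1), ∑ q ∈ Finset.range (n + 1),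
        if 2 * q + r = a then ((tailPerms k q (q + r)).card : Polynomial ℚ) ^ 2 *
          PowerSeries.coeff (n - a) (M (((k - r : ℕ) : ℤ) - 1)) else 0 := by
    intro r _
    rw [Finset.Nat.sum_antidiagonal_eq_sum_range_succ_mk]
    refine Finset.sum_congr rfl fun a ha => ?_
    rw [Finset.mem_range] at ha
    rw [← Nat.cast_pow, sq_stripPaths (show a ≤ n by omega), Nat.cast_sum, Finset.sum_mul]
    refine Finset.sum_congr rfl fun q _ => ?_
    split_ifs <;> simp
  rw [Finset.sum_congr rfl hR]
  simp_rw [← Finset.sum_product']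
  rw [← Finset.sum_filter]
  set I := (Finset.range (k + 1) ×ˢ (Finset.range (n + 1) ×ˢ Finset.range (n + 1))).filter
    (fun x => 2 * x.2.2 + x.1 = x.2.1) with hI
  have hmem : ∀ {r a q}, (r, a, q) ∈ I ↔ r ≤ k ∧ a ≤ n ∧ 2 * q + r = a := by
    intro r a q
    simp only [hI, Finset.mem_filter, Finset.mem_product, Finset.mem_range]
    omega
  have h1 : ∀ π ∈ (Finset.univ.filter fun π : Equiv.Perm (Fin (n + 1)) => Good k π),
      ∑ i with π i = i, (Polynomial.X : Polynomial ℚ) ^ fpBelow π i =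
      ∑ x ∈ I, ∑ i with π i = i,
        if x.2.2 + (n - x.2.1) = i.val ∧ Corner x.2.2 (n - x.2.1 + 1) π then
          (Polynomial.X : Polynomial ℚ) ^ fpBelow π i else 0 := by
    intro π hπ
    rw [Finset.mem_filter] at hπ
    rw [Finset.sum_comm]
    refine Finset.sum_congr rfl fun i hi => ?_
    rw [Finset.mem_filter] at hi
    obtain ⟨q, p, r, hqp, hn, hc⟩ := exists_corner_succ hπ.2 hi.2
    have hk := le_add_of_good_of_corner (show q + (p + 1) + (q + r) = n + 1 by omega) (by omega)
      hπ.2 hc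
    obtain rfl : p = n - (2 * q + r) := by omega
    rw [Finset.sum_eq_single_of_mem (r, 2 * q + r, q), if_pos ⟨hqp, hc⟩]
    · exact hmem.2 ⟨by omega, by omega, rfl⟩
    · rintro ⟨r', a', q'⟩ hx hne
      rw [hmem] at hx
      refine if_neg fun hc' => hne ?_
      simp only at hc'
      have := corner_succ_unique (by omega) (by omega) (hqp.trans hc'.1.symm) hc hc'.2
      rw [Prod.mk.injEq, Prod.mk.injEq]
      omega
  rw [Finset.sum_congr rfl h1, Finset.sum_comm]
  refine Finset.sum_congr rfl ?_
  rintro ⟨r, a, q⟩ hx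
  rw [hmem] at hx
  obtain ⟨hr, ha, hqa⟩ := hx
  simp only
  obtain ⟨p, hp⟩ : ∃ p, p = n - a := ⟨_, rfl⟩
  rw [← hp]
  have hi0 : ((⟨q + p, by omega⟩ : Fin (n + 1)) : ℕ) = q + p := rfl
  set i0 : Fin (n + 1) := ⟨q + p, by omega⟩
  have h2 : ∀ π : Equiv.Perm (Fin (n + 1)),
      (∑ i with π i = i, if q + p = i.val ∧ Corner q (p + 1) π then
          (Polynomial.X : Polynomial ℚ) ^ fpBelow π i else 0) =
      if Corner q (p + 1) π then
        (if π i0 = i0 then (Polynomial.X : Polynomial ℚ) ^ fpBelow π i0 else 0) else 0 := by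
    intro π
    rw [Finset.sum_filter, Finset.sum_eq_single i0]
    · by_cases hc : Corner q (p + 1) π <;> simp [hc, hi0]
    · intro i _ hne
      have : q + p ≠ i.val := fun h => hne (Fin.ext (by rw [hi0, h]))
      simp [this]
    · simp
  simp_rw [h2]
  rw [← Finset.sum_filter, Finset.filter_filter,
    sum_corner (show q + (p + 1) + (q + r) = n + 1 by omega) (by omega) (by omega)]
  simp_rw [glue_apply_eq_self_iff hi0, fpBelow_glue hi0]
  rw [sum_good_fixing_last, Finset.sum_const, Finset.sum_const, nsmul_eq_mul, nsmul_eq_mul,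
    ← mul_assoc, ← sq, Nat.add_sub_cancel_left]

/-! ### Assembling the recurrence -/

/-- The exponents on the right run through `0, …, s.card - 1`, so this is the geometric sum. -/
theorem pow_card_eq {R ι : Type*} [CommRing R] [LinearOrder ι] (x : R) (s : Finset ι) :
    x ^ s.card = 1 + (x - 1) * ∑ i ∈ s, x ^ (s.filter (· < i)).card := by
  induction s using Finset.induction_on_max with
  | empty => simp
  | insert a s ha ih =>
    have hna : a ∉ s := fun h => lt_irrefl a (ha a h)
    have h1 : (insert a s).filter (· < a) = s := by
      ext y
      simp only [Finset.mem_filter, Finset.mem_insert]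
      exact ⟨fun h => h.1.resolve_left h.2.ne, fun h => ⟨Or.inr h, ha y h⟩⟩
    have h2 : ∀ i ∈ s, x ^ ((insert a s).filter (· < i)).card = x ^ (s.filter (· < i)).card := by
      intro i hi
      rw [Finset.filter_insert, if_neg (not_lt.2 (ha i hi).le)]
    rw [Finset.sum_insert hna, h1, Finset.sum_congr rfl h2, Finset.card_insert_of_notMem hna,
      pow_succ]
    linear_combination ih

theorem pow_fp_eq {R : Type*} [CommRing R] (x : R) {n : ℕ} (π : Equiv.Perm (Fin n)) :
    x ^ fp π = 1 + (x - 1) * ∑ i with π i = i, x ^ fpBelow π i := by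
  rw [fp, pow_card_eq]
  congr 2
  refine Finset.sum_congr rfl fun i _ => ?_
  rw [fpBelow, Finset.filter_filter]
  simp_rw [and_comm]

theorem coeff_G {k l r : ℕ} (h : l + r = k) (n : ℕ) :
    PowerSeries.coeff n (G k l) = (stripPaths k n r : Polynomial ℚ) ^ 2 := by
  rw [G, PowerSeries.coeff_mk, g_eq_stripPaths h]
  simp

theorem M_recurrence (k : ℕ) :
    M (k : ℤ) = ∑ l ∈ Finset.range (k + 1),
      G k l * (1 + PowerSeries.C (Polynomial.X - 1 : Polynomial ℚ) * PowerSeries.X *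
        M ((l : ℤ) - 1)) := by
  classical
  have hterm : ∀ l, G k l * (1 + PowerSeries.C (Polynomial.X - 1 : Polynomial ℚ) *
      PowerSeries.X * M ((l : ℤ) - 1)) = G k l + PowerSeries.C (Polynomial.X - 1 : Polynomial ℚ) *
      (PowerSeries.X * (G k l * M ((l : ℤ) - 1))) := fun l => by ring
  -- Replacing `ℓ` by `r = k - ℓ` indexes the sum by the final height of the paths.
  rw [← Finset.sum_range_reflect]
  simp_rw [hterm]
  ext1 n
  rw [coeff_M, Finset.sum_congr rfl fun π _ => pow_fp_eq Polynomial.X π, Finset.sum_add_distrib,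
    ← Finset.mul_sum, Finset.sum_const, card_good_eq, map_sum]
  simp_rw [map_add, PowerSeries.coeff_C_mul]
  rw [Finset.sum_add_distrib, ← Finset.mul_sum]
  congr 1
  · rw [nsmul_one, Nat.cast_sum]
    refine Finset.sum_congr rfl fun r hr => ?_
    rw [Finset.mem_range] at hr
    rw [coeff_G (r := r) (by omega), Nat.cast_pow]
  · congr 1
    cases n with
    | zero => simp
    | succ n =>
      rw [sum_fixed_points]
      refine Finset.sum_congr rfl fun r hr => ?_
      rw [Finset.mem_range] at hr
      rw [PowerSeries.coeff_succ_X_mul, PowerSeries.coeff_mul]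
      refine Finset.sum_congr rfl fun x _ => ?_
      rw [coeff_G (r := r) (by omega), show k + 1 - 1 - r = k - r by omega]

end PatternAvoid

/-- The first two conjuncts say that the series defining `g_{k,ℓ}` makes sense: its denominator is
non-zero and the quotient is a power series `∑_{n ≥ 0} g_{k,ℓ}(n) z^n`. The last two are the initial
condition and the recurrence. -/
theorem mainTheorem5 (k : ℕ) :
    PatternAvoid.UL (k + 1) ≠ 0 ∧
    (∀ l ≤ k, HahnSeries.ofPowerSeries ℤ ℚ (PowerSeries.mk (PatternAvoid.g k l)) =
      PatternAvoid.UL l / (PatternAvoid.zL * PatternAvoid.UL (k + 1))) ∧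
    PatternAvoid.M (-1) = 0 ∧
    PatternAvoid.M (k : ℤ) = ∑ l ∈ Finset.range (k + 1),
      PatternAvoid.G k l *
        (1 + PowerSeries.C (Polynomial.X - 1 : Polynomial ℚ) * PowerSeries.X *
          PatternAvoid.M ((l : ℤ) - 1)) := by
  exact ⟨PatternAvoid.UL_succ_ne_zero k, fun _ h => PatternAvoid.ofPowerSeries_mk_g h,
    PatternAvoid.M_neg_one, PatternAvoid.M_recurrence k⟩
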